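/- Let $X=(X_t)_{t\ge 0}$ be a subordinator on a probability space, i.e. a real-valued process with $X_0=0$, stationary independent increments and non-decreasing right-continuous paths. For $\delta>0$ let $\tilde X^\delta$ be the process of $\delta$-shortened jumps, obtained from $X$ by shortening every jump of size larger than $\delta$ to size $\delta$, that is, \[ \tilde X^\delta_t = X_t-\sum_{0<s\le t}\bigl(X_s-X_{s-}-\delta\bigr)^+ , \] and put $L(t,\delta)=\tfrac1\delta \tilde X^\delta_t$ for $t,\delta>0$. Let $\Phi$ be the Laplace exponent of $X$, defined by $e^{-\Phi(\lambda)}=\mathbb E[e^{-\lambda X_1}]$ for $\lambda\ge 0$. Suppose that $\Phi$ is regularly varying at infinity in the sense that \[ \Phi(\lambda)\sim\lambda^{\alpha}F(\lambda)\qquad(\lambda\to\infty) \] for some $\alpha\in(0,1)$ and some function $F$ that is slowly varying at infinity (i.e. $F$ is positive and measurable on some half-line $[A,\infty)$, and $F(c\lambda)/F(\lambda)\to1$ as $\lambda\to\infty$ for every $c>0$). Then, almost surely, for all $t>0$ simultaneously, \[ L(t,\delta)\sim\frac{t\,\delta^{-\alpha}F(1/\delta)}{\Gamma(2-\alpha)}\qquad(\delta\to0^+),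 \] where $f\sim g$ means $f/g\to1$. -/

import Mathlib

open MeasureTheory ProbabilityTheory Filter Topology Asymptotics
open scoped NNReal

/-- A subordinator on the probability space `(Ω, P)`: a real-valued process `X` indexed by
`[0, ∞)` which starts at the origin, has independent and stationary increments, and whose sample
paths are almost surely non-decreasing and right-continuous (a non-decreasing path has left limits
automatically, so the paths are almost surely càdlàg). -/
structure IsSubordinator {Ω : Type*} [MeasurableSpace Ω] (X : ℝ≥0 → Ω → ℝ) (P : Measure Ω) :
    Prop where
  measurable : ∀ t, Measurable (X t)
  zero : ∀ᵐ ω ∂P, X 0 ω = 0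
  indep : HasIndepIncrements X P
  stationary : ∀ s h, IdentDistrib (X (s + h) - X s) (X h) P P
  mono : ∀ᵐ ω ∂P, Monotone (fun t ↦ X t ω)
  rightCont : ∀ᵐ ω ∂P, ∀ t, ContinuousWithinAt (fun s ↦ X s ω) (Set.Ici t) t

/-- The Laplace exponent `Φ(u) = -log E[exp(-u X₁)]`, that is, `exp(-Φ(u)) = E[exp(-u X₁)]`,
to be read for `u ≥ 0`. -/
noncomputable def laplaceExponent {Ω : Type*} [MeasurableSpace Ω] (X : ℝ≥0 → Ω → ℝ)
    (P : Measure Ω) (u : ℝ) : ℝ :=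
  -Real.log (∫ ω, Real.exp (-u * X 1 ω) ∂P)

/-- `F` is slowly varying at infinity: it is positive and measurable on some half-line `[A, ∞)`,
and `F (c x) / F x → 1` as `x → ∞`, for every `c > 0`. -/
def IsSlowlyVarying (F : ℝ → ℝ) : Prop :=
  (∃ A : ℝ, (∀ x, A ≤ x → 0 < F x) ∧ Measurable (fun x : Set.Ici A ↦ F x)) ∧
    ∀ c : ℝ, 0 < c → Tendsto (fun x ↦ F (c * x) / F x) atTop (𝓝 1)

/-- The size `f(s) - f(s-)` of the jump of the path `f` at time `s`
(at `s = 0` it is `0`, since `Function.leftLim f 0 = f 0` on `[0, ∞)`). -/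
noncomputable def jumpSize (f : ℝ≥0 → ℝ) (s : ℝ≥0) : ℝ :=
  f s - Function.leftLim f s

/-- The path `f` with every jump of size larger than `δ` shortened to size `δ`: from `f t`, the
excess `(f(s) - f(s-) - δ)⁺` of each jump at a time `s ∈ (0, t]` is removed. For a non-decreasing
path and `δ > 0` only finitely many terms of the sum are nonzero. -/
noncomputable def shortenJumps (δ : ℝ) (f : ℝ≥0 → ℝ) (t : ℝ≥0) : ℝ :=
  f t - ∑' s : Set.Ioc (0 : ℝ≥0) t, max (jumpSize f s - δ) 0

/-- `L(t, δ) = δ⁻¹ X̃ᵟ_t` at the sample point `ω`, where `X̃ᵟ` is the process of `δ`-shortened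
jumps of `X`. -/
noncomputable def shortenedCount {Ω : Type*} (X : ℝ≥0 → Ω → ℝ) (t : ℝ≥0) (δ : ℝ) (ω : Ω) : ℝ :=
  (1 / δ) * shortenJumps δ (fun s ↦ X s ω) t

/-! Write `μ` for the Stieltjes measure of a path and `J(s)` for its jump at `s`. Then `L(t, δ)` is
the integral of `1 / max(J, δ)` over `(0, t]` against `μ` (`shortenJumps_eq_integral`). Hence `L`
decreases in `δ`, increases in `t`, and is the limit of the sums of `min(increment / δ, 1)` over
dyadic partitions of `(0, t]` (`tendsto_sum_min_increments`). For a subordinator the summands are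
i.i.d. with values in `[0, 1]`, so the Lévy measure and the Lévy–Itô decomposition are not needed.

Means: let `U(δ)` be the limit of `2ⁿ E[min(X_{t/2ⁿ}, δ)]`. Since `1 - exp(-r x)` is the integral
over `δ > 0` of `r² exp(-r δ) min(x, δ)`, the Laplace transform of `U` at `r` is `t Φ(r) / r²`
(`integrableOn_and_laplace_truncMean`). As `U` is monotone, a Tauberian theorem
(`tendsto_of_laplace_regularlyVarying`) gives the claimed asymptotics for `M(δ) = U(δ) / δ`.

Fluctuations: a sum of independent `[0, 1]`-valued variables has variance at most its mean, so `E[(L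
- M)²] ≤ M` (`lintegral_sq_shortenedCount_sub_le`). Along `δ = rᵏ` the inverses `1 / M` are summable
because `α > 0`, hence `L / M → 1` almost surely. Monotonicity in `δ` fills the gaps at the cost of
factors tending to `1` as `r ↑ 1` (`tendsto_div_of_tendsto_geometric`), and monotonicity in `t`
passes from rational times to all times on a single almost sure event. -/

/-! ### Shortened jumps of a deterministic path. -/

/-- A monotone right-continuous path, as a Stieltjes function. -/
def pathStieltjes (f : ℝ≥0 → ℝ) (hm : Monotone f)
    (hc : ∀ t, ContinuousWithinAt f (Set.Ici t) t) : StieltjesFunction ℝ≥0 :=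
  ⟨f, hm, hc⟩

theorem integrableOn_inv_max (g : StieltjesFunction ℝ≥0) {δ : ℝ} (hδ : 0 < δ) {h : ℝ≥0 → ℝ}
    (hh : Measurable h) (t : ℝ≥0) :
    IntegrableOn (fun s ↦ (max (h s) δ)⁻¹) (Set.Ioc 0 t) g.measure := by
  refine Measure.integrableOn_of_bounded (M := δ⁻¹) (by simp) ?_ ?_
  · exact ((hh.max measurable_const).inv).aestronglyMeasurable
  · refine Eventually.of_forall fun s ↦ ?_
    rw [Real.norm_eq_abs, abs_of_pos (by positivity)]
    gcongr
    exact le_max_right _ _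

theorem measurable_jumpSize {f : ℝ≥0 → ℝ} (hm : Monotone f) : Measurable (jumpSize f) :=
  hm.measurable.sub hm.leftLim.measurable

/-- The difference `1/δ - 1/max(J, δ)` vanishes off the finitely many jumps larger than `δ`. Such a
jump is an atom of mass `J` and contributes `J (1/δ - 1/J) = (J - δ)/δ`, its excess divided by `δ`.
In the integral form, monotonicity in `δ` and in `t` becomes immediate. -/
theorem shortenJumps_eq_integral {f : ℝ≥0 → ℝ} (hm : Monotone f)
    (hc : ∀ t, ContinuousWithinAt f (Set.Ici t) t) (h0 : f 0 = 0) {δ : ℝ} (hδ : 0 < δ) (t : ℝ≥0) :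
    (1 / δ) * shortenJumps δ f t =
      ∫ s in Set.Ioc 0 t, (max (jumpSize f s) δ)⁻¹ ∂(pathStieltjes f hm hc).measure := by
  set g := pathStieltjes f hm hc
  set μ := g.measure with hμ
  have hg : (g : ℝ≥0 → ℝ) = f := rfl
  have hfin : μ (Set.Ioc 0 t) ≠ ⊤ := by simp [hμ]
  set A : Set ℝ≥0 := {s | s ∈ Set.Ioc 0 t ∧ δ < jumpSize f s} with hA
  -- Each point of `A` is an atom of mass at least `δ`, and `(0, t]` has finite mass.
  have hAfin : A.Finite := by
    have : Set.Finite {s | ENNReal.ofReal δ ≤ (μ.restrict (Set.Ioc 0 t)) {s}} := by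
      apply Measure.finite_const_le_meas_of_disjoint_iUnion (μ.restrict (Set.Ioc 0 t))
        (ENNReal.ofReal_pos.2 hδ) (fun s ↦ measurableSet_singleton s)
      · intro a b hab
        simpa [Function.onFun] using hab
      · exact ((measure_mono (Set.subset_univ _)).trans_lt (by simpa using hfin.lt_top)).ne
    refine this.subset fun s hs ↦ ?_
    simp only [Set.mem_ofPred_eq]
    rw [Measure.restrict_apply (measurableSet_singleton s),
      Set.inter_eq_left.2 (Set.singleton_subset_iff.2 hs.1), hμ, g.measure_singleton]
    exact ENNReal.ofReal_le_ofReal hs.2.le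
  have hint : IntegrableOn (fun s ↦ (max (jumpSize f s) δ)⁻¹) (Set.Ioc 0 t) μ :=
    integrableOn_inv_max g hδ (measurable_jumpSize hm) t
  have key : ∫ s in Set.Ioc 0 t, (1 / δ - (max (jumpSize f s) δ)⁻¹) ∂μ =
      (1 / δ) * ∑' s : Set.Ioc (0 : ℝ≥0) t, max (jumpSize f s - δ) 0 := by
    have h1 : ∫ s in Set.Ioc 0 t, (1 / δ - (max (jumpSize f s) δ)⁻¹) ∂μ =
        ∫ s in (hAfin.toFinset : Set ℝ≥0), (1 / δ - (max (jumpSize f s) δ)⁻¹) ∂μ := by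
      apply setIntegral_eq_of_subset_of_forall_sdiff_eq_zero measurableSet_Ioc
      · intro s hs
        simp only [Set.Finite.coe_toFinset] at hs
        exact hs.1
      · intro s hs
        have : jumpSize f s ≤ δ := by
          by_contra hcon
          exact hs.2 (by rw [Set.Finite.coe_toFinset]; exact ⟨hs.1, not_le.1 hcon⟩)
        simp [max_eq_right this]
    rw [h1, setIntegral_finset]
    · have h2 : ∑' s : Set.Ioc (0 : ℝ≥0) t, max (jumpSize f s - δ) 0 =
          ∑ s ∈ hAfin.toFinset, max (jumpSize f s - δ) 0 := by
        rw [tsum_subtype (Set.Ioc (0 : ℝ≥0) t) (fun s ↦ max (jumpSize f s - δ) 0)]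
        rw [tsum_eq_sum (s := hAfin.toFinset)]
        · refine Finset.sum_congr rfl fun s hs ↦ ?_
          rw [Set.indicator_of_mem]
          exact ((Set.Finite.mem_toFinset _).1 hs).1
        · intro s hs
          by_cases hs' : s ∈ Set.Ioc 0 t
          · have : jumpSize f s ≤ δ := by
              by_contra hcon
              exact hs ((Set.Finite.mem_toFinset _).2 ⟨hs', not_le.1 hcon⟩)
            simp [this]
          · simp [Set.indicator_of_notMem hs']
      rw [h2, Finset.mul_sum]
      refine Finset.sum_congr rfl fun s hs ↦ ?_
      have hs' := ((Set.Finite.mem_toFinset _).1 hs).2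
      have hj : (0 : ℝ) < jumpSize f s := hδ.trans hs'
      have : μ.real {s} = jumpSize f s := by
        rw [Measure.real, hμ, g.measure_singleton, hg]
        exact ENNReal.toReal_ofReal hj.le
      rw [this, max_eq_left hs'.le, max_eq_left (by linarith), smul_eq_mul]
      field_simp
    · refine IntegrableOn.mono_set (t := Set.Ioc 0 t) ?_ ?_
      · exact Integrable.sub (integrableOn_const hfin) hint
      · intro s hs
        simp only [Set.Finite.coe_toFinset] at hs
        exact hs.1
  rw [integral_sub (integrableOn_const (s := Set.Ioc 0 t) hfin).integrable hint, setIntegral_const] at key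
  have : μ.real (Set.Ioc 0 t) = f t := by
    rw [Measure.real, hμ, g.measure_Ioc, hg, h0, sub_zero, ENNReal.toReal_ofReal]
    rw [← h0]; exact hm zero_le
  rw [this, smul_eq_mul] at key
  rw [shortenJumps]
  linear_combination key

theorem shortenJumps_nonneg {f : ℝ≥0 → ℝ} (hm : Monotone f)
    (hc : ∀ t, ContinuousWithinAt f (Set.Ici t) t) (h0 : f 0 = 0) {δ : ℝ} (hδ : 0 < δ) (t : ℝ≥0) :
    0 ≤ (1 / δ) * shortenJumps δ f t := by
  rw [shortenJumps_eq_integral hm hc h0 hδ]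
  exact integral_nonneg fun s ↦ inv_nonneg.2 (hδ.le.trans (le_max_right _ _))

theorem shortenJumps_mono_time {f : ℝ≥0 → ℝ} (hm : Monotone f)
    (hc : ∀ t, ContinuousWithinAt f (Set.Ici t) t) (h0 : f 0 = 0) {δ : ℝ} (hδ : 0 < δ)
    {s t : ℝ≥0} (hst : s ≤ t) :
    (1 / δ) * shortenJumps δ f s ≤ (1 / δ) * shortenJumps δ f t := by
  rw [shortenJumps_eq_integral hm hc h0 hδ, shortenJumps_eq_integral hm hc h0 hδ]
  refine setIntegral_mono_set (integrableOn_inv_max _ hδ (measurable_jumpSize hm) t) ?_ ?_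
  · exact Eventually.of_forall fun x ↦ inv_nonneg.2 (hδ.le.trans (le_max_right _ _))
  · exact (Set.Ioc_subset_Ioc_right hst).eventuallyLE

theorem shortenJumps_anti_size {f : ℝ≥0 → ℝ} (hm : Monotone f)
    (hc : ∀ t, ContinuousWithinAt f (Set.Ici t) t) (h0 : f 0 = 0) {δ ε : ℝ} (hδ : 0 < δ)
    (h : δ ≤ ε) (t : ℝ≥0) :
    (1 / ε) * shortenJumps ε f t ≤ (1 / δ) * shortenJumps δ f t := by
  have hε := hδ.trans_le h
  rw [shortenJumps_eq_integral hm hc h0 hδ, shortenJumps_eq_integral hm hc h0 hε]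
  refine setIntegral_mono (integrableOn_inv_max _ hε (measurable_jumpSize hm) t)
    (integrableOn_inv_max _ hδ (measurable_jumpSize hm) t) fun s ↦ ?_
  exact inv_anti₀ (lt_max_of_lt_right hδ) (max_le_max le_rfl h)

/-- The sum is the integral of `1 / max(D, δ)`, where `D(s)` is the increment over the dyadic cell
containing `s`. As the cells shrink, `D(s)` tends to the jump at `s`, and `1/δ` dominates. -/
theorem tendsto_sum_min_increments {f : ℝ≥0 → ℝ} (hm : Monotone f)
    (hc : ∀ t, ContinuousWithinAt f (Set.Ici t) t) (h0 : f 0 = 0) {δ : ℝ} (hδ : 0 < δ) {t : ℝ≥0}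
    (ht : 0 < t) :
    Tendsto (fun n : ℕ ↦ ∑ k ∈ Finset.range (2 ^ n),
      min ((f ((k + 1 : ℕ) * (t / 2 ^ n)) - f (k * (t / 2 ^ n))) / δ) 1) atTop
      (𝓝 ((1 / δ) * shortenJumps δ f t)) := by
  rw [shortenJumps_eq_integral hm hc h0 hδ]
  set g := pathStieltjes f hm hc
  set μ := g.measure with hμ
  have hg : (g : ℝ≥0 → ℝ) = f := rfl
  -- `K n s` numbers the cell `(a n s, b n s]` containing `s`. The truncated subtraction `K n s - 1`
  -- matters only at `s = 0`, which lies outside `(0, t]`.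
  set K : ℕ → ℝ≥0 → ℕ := fun n s ↦ ⌈s / (t / 2 ^ n)⌉₊ with hK
  set b : ℕ → ℝ≥0 → ℝ≥0 := fun n s ↦ (K n s : ℝ≥0) * (t / 2 ^ n) with hb
  set a : ℕ → ℝ≥0 → ℝ≥0 := fun n s ↦ ((K n s - 1 : ℕ) : ℝ≥0) * (t / 2 ^ n) with ha
  have hpos : ∀ n : ℕ, 0 < t / 2 ^ n := fun n ↦ by positivity
  have hKm : ∀ n, Measurable (K n) := fun n ↦ Nat.measurable_ceil.comp (by fun_prop)
  have hDm : ∀ n, Measurable (fun s ↦ f (b n s) - f (a n s)) := fun n ↦ by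
    apply Measurable.sub
    · exact (measurable_from_top (f := fun k : ℕ ↦ f ((k : ℝ≥0) * (t / 2 ^ n)))).comp (hKm n)
    · exact (measurable_from_top (f := fun k : ℕ ↦ f (((k - 1 : ℕ) : ℝ≥0) * (t / 2 ^ n)))).comp
        (hKm n)
  have hlim : Tendsto (fun n : ℕ ↦ t / 2 ^ n) atTop (𝓝 0) := by
    have := tendsto_pow_atTop_nhds_zero_of_lt_one (r := (1 / 2 : ℝ≥0)) (by positivity)
      (by rw [div_lt_one] <;> norm_num)
    have := this.const_mul t
    simpa [div_eq_mul_inv] using this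
  have hsb : ∀ n s, s ≤ b n s := fun n s ↦ by
    have := Nat.le_ceil (s / (t / 2 ^ n))
    rwa [div_le_iff₀ (hpos n)] at this
  have hba : ∀ n s, 0 < s → b n s = a n s + t / 2 ^ n := fun n s hs ↦ by
    have : 0 < K n s := Nat.ceil_pos.2 (div_pos hs (hpos n))
    simp only [hb, ha]
    obtain ⟨m, hm⟩ := Nat.exists_eq_succ_of_ne_zero this.ne'
    rw [hm, Nat.succ_sub_one]; push_cast; ring
  have has : ∀ n s, 0 < s → a n s < s := fun n s hs ↦ by
    have h1 : K n s - 1 < K n s := Nat.sub_lt (Nat.ceil_pos.2 (div_pos hs (hpos n))) one_pos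
    have := Nat.lt_ceil.1 h1
    rwa [lt_div_iff₀ (hpos n)] at this
  have hat : ∀ s, 0 < s → Tendsto (fun n ↦ a n s) atTop (𝓝 s) := fun s hs ↦ by
    have h1 : Tendsto (fun n : ℕ ↦ s - t / 2 ^ n) atTop (𝓝 s) := by
      simpa using tendsto_const_nhds.sub hlim
    refine tendsto_of_tendsto_of_tendsto_of_le_of_le h1 tendsto_const_nhds (fun n ↦ ?_)
      (fun n ↦ (has n s hs).le)
    rw [tsub_le_iff_right, ← hba n s hs]
    exact hsb n s
  have hbt : ∀ s, 0 < s → Tendsto (fun n ↦ b n s) atTop (𝓝 s) := fun s hs ↦ by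
    have := (hat s hs).add hlim
    simp only [add_zero] at this
    exact this.congr fun n ↦ (hba n s hs).symm
  -- The cells are open on the left and closed on the right: `b n s ≥ s` calls for right continuity,
  -- and the strict `a n s < s` for the left limit.
  have hDt : ∀ s, 0 < s → Tendsto (fun n ↦ f (b n s) - f (a n s)) atTop (𝓝 (jumpSize f s)) := by
    intro s hs
    refine Tendsto.sub ?_ ?_
    · exact (hc s).tendsto.comp (tendsto_nhdsWithin_iff.2
        ⟨hbt s hs, Eventually.of_forall fun n ↦ hsb n s⟩)
    · exact (hm.tendsto_leftLim s).comp (tendsto_nhdsWithin_iff.2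
        ⟨hat s hs, Eventually.of_forall fun n ↦ has n s hs⟩)
  have hmain : Tendsto (fun n ↦ ∫ s in Set.Ioc 0 t, (max (f (b n s) - f (a n s)) δ)⁻¹ ∂μ) atTop
      (𝓝 (∫ s in Set.Ioc 0 t, (max (jumpSize f s) δ)⁻¹ ∂μ)) := by
    refine tendsto_integral_of_dominated_convergence (fun _ ↦ δ⁻¹) ?_ ?_ ?_ ?_
    · exact fun n ↦ (((hDm n).max measurable_const).inv).aestronglyMeasurable
    · exact integrableOn_const (by simp [hμ])
    · refine fun n ↦ Eventually.of_forall fun s ↦ ?_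
      rw [Real.norm_eq_abs, abs_of_pos (by positivity)]
      exact inv_anti₀ hδ (le_max_right _ _)
    · refine (ae_restrict_iff' measurableSet_Ioc).2 (Eventually.of_forall fun s hs ↦ ?_)
      exact ((hDt s hs.1).max tendsto_const_nhds).inv₀ (by positivity)
  refine hmain.congr fun n ↦ ?_
  set c : ℕ → ℝ≥0 := fun k ↦ (k : ℝ≥0) * (t / 2 ^ n) with hcdef
  have hcm : Monotone c := fun i j hij ↦ by simp only [hcdef]; gcongr
  have hind : ∀ m : ℕ, ∫ s in Set.Ioc 0 (c m), (max (f (b n s) - f (a n s)) δ)⁻¹ ∂μ =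
      ∑ k ∈ Finset.range m, min ((f (c (k + 1)) - f (c k)) / δ) 1 := by
    intro m
    induction m with
    | zero => simp [hcdef]
    | succ m ih =>
      have hle : c m ≤ c (m + 1) := hcm (Nat.le_succ m)
      rw [Finset.sum_range_succ, ← ih, ← Set.Ioc_union_Ioc_eq_Ioc zero_le hle,
        setIntegral_union (Set.Ioc_disjoint_Ioc_of_le le_rfl) measurableSet_Ioc
          (integrableOn_inv_max g hδ (hDm n) _)
          ((integrableOn_inv_max g hδ (hDm n) (c (m + 1))).mono_set
            (Set.Ioc_subset_Ioc_left zero_le))]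
      congr 1
      have hcongr : ∀ s ∈ Set.Ioc (c m) (c (m + 1)), (max (f (b n s) - f (a n s)) δ)⁻¹ =
          (max (f (c (m + 1)) - f (c m)) δ)⁻¹ := by
        intro s hs
        have : K n s = m + 1 := by
          rw [hK]
          simp only
          rw [Nat.ceil_eq_iff (by simp)]
          refine ⟨?_, ?_⟩
          · rw [lt_div_iff₀ (hpos n)]; simpa using hs.1
          · rw [div_le_iff₀ (hpos n)]; exact hs.2
        simp only [hb, ha, this, hcdef]
        simp
      rw [setIntegral_congr_fun measurableSet_Ioc hcongr, setIntegral_const, Measure.real,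
        g.measure_Ioc, hg, ENNReal.toReal_ofReal (sub_nonneg.2 (hm hle)), smul_eq_mul]
      set D := f (c (m + 1)) - f (c m)
      have hD : 0 ≤ D := sub_nonneg.2 (hm hle)
      -- A cell has mass `D`, and `D / max(D, δ) = min(D/δ, 1)`.
      rcases le_total D δ with h | h
      · rw [max_eq_right h, min_eq_left (by rwa [div_le_one hδ])]; rfl
      · rw [max_eq_left h, min_eq_right (by rwa [one_le_div hδ]), mul_inv_cancel₀ (by linarith)]
  have h2 := hind (2 ^ n)
  have h3 : c (2 ^ n) = t := by simp only [hcdef]; push_cast; field_simp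
  rw [h3] at h2
  exact h2

/-! ### Tauberian theory: from Laplace transforms to monotone densities. -/

/-- The method of moments for densities of a `[0, 1]`-valued function `Y`. -/
theorem tendsto_integral_comp_of_tendsto_moments {E ι : Type*} [MeasurableSpace E] {ν : Measure E}
    {l : Filter ι} {Y : E → ℝ} (hY : Measurable Y) (hY01 : ∀ᵐ x ∂ν, Y x ∈ Set.Icc (0 : ℝ) 1)
    {v : ι → E → ℝ} {w : E → ℝ} (hv : ∀ᶠ i in l, Integrable (v i) ν) (hw : Integrable w ν)
    (hv0 : ∀ᶠ i in l, 0 ≤ᵐ[ν] v i) (hw0 : 0 ≤ᵐ[ν] w)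
    (hmom : ∀ k : ℕ, Tendsto (fun i ↦ ∫ x, Y x ^ k * v i x ∂ν) l (𝓝 (∫ x, Y x ^ k * w x ∂ν)))
    {g : ℝ → ℝ} (hg : Continuous g) :
    Tendsto (fun i ↦ ∫ x, g (Y x) * v i x ∂ν) l (𝓝 (∫ x, g (Y x) * w x ∂ν)) := by
  have hint : ∀ {h : ℝ → ℝ}, Continuous h → ∀ {u : E → ℝ}, Integrable u ν →
      Integrable (fun x ↦ h (Y x) * u x) ν := by
    intro h hh u hu
    obtain ⟨c, hc⟩ := isCompact_Icc.exists_bound_of_continuousOn (hh.continuousOn (s := Set.Icc 0 1))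
    exact hu.bdd_mul (hh.measurable.comp hY).aestronglyMeasurable
      (hY01.mono fun x hx ↦ hc _ hx)
  have hpoly : ∀ p : Polynomial ℝ, Tendsto (fun i ↦ ∫ x, p.eval (Y x) * v i x ∂ν) l
      (𝓝 (∫ x, p.eval (Y x) * w x ∂ν)) := by
    intro p
    induction p using Polynomial.induction_on' with
    | add p q hp hq =>
      simp only [Polynomial.eval_add, add_mul]
      rw [integral_add (hint p.continuous hw) (hint q.continuous hw)]
      refine (hp.add hq).congr' ?_
      filter_upwards [hv] with i hi
      rw [integral_add (hint p.continuous hi) (hint q.continuous hi)]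
    | monomial n a =>
      simp only [Polynomial.eval_monomial, mul_assoc, integral_const_mul]
      exact (hmom n).const_mul a
  have happrox : ∀ {p : Polynomial ℝ} {ε : ℝ},
      (∀ y ∈ Set.Icc (0 : ℝ) 1, |p.eval y - g y| < ε) → ∀ {u : E → ℝ}, Integrable u ν →
      0 ≤ᵐ[ν] u →
      |∫ x, p.eval (Y x) * u x ∂ν - ∫ x, g (Y x) * u x ∂ν| ≤ ε * ∫ x, u x ∂ν := by
    intro p ε hp u hu hu0
    rw [← integral_sub (hint p.continuous hu) (hint hg hu), ← integral_const_mul]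
    refine (norm_integral_le_integral_norm _).trans (integral_mono_ae
      ((hint p.continuous hu).sub (hint hg hu)).norm (hu.const_mul ε) ?_)
    filter_upwards [hY01, hu0] with x hx hx0
    simp only [Pi.zero_apply] at hx0
    rw [Pi.sub_apply, ← sub_mul, norm_mul, Real.norm_eq_abs, Real.norm_eq_abs, abs_of_nonneg hx0]
    exact mul_le_mul_of_nonneg_right (hp _ hx).le hx0
  have hmass : Tendsto (fun i ↦ ∫ x, v i x ∂ν) l (𝓝 (∫ x, w x ∂ν)) := by simpa using hmom 0
  have hW : 0 ≤ ∫ x, w x ∂ν := integral_nonneg_of_ae hw0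
  rw [Metric.tendsto_nhds]
  intro ε hε
  -- `C` exceeds the limiting mass, so eventually it bounds the masses of `v i` as well, and
  -- replacing `g` by the polynomial costs less than `ε/3` on each side.
  set C := ∫ x, w x ∂ν + 1 with hC
  have hCpos : 0 < C := by positivity
  obtain ⟨p, hp⟩ := exists_polynomial_near_of_continuousOn 0 1 g hg.continuousOn (ε / (3 * C))
    (by positivity)
  have hbound : ∀ {m : ℝ}, m < C → ε / (3 * C) * m < ε / 3 := by
    intro m hm
    calc ε / (3 * C) * m < ε / (3 * C) * C := by gcongr
      _ = ε / 3 := by field_simp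
  filter_upwards [hv, hv0, hmass.eventually (gt_mem_nhds (show ∫ x, w x ∂ν < C by rw [hC]; linarith)),
    (Metric.tendsto_nhds.1 (hpoly p)) (ε / 3) (by positivity)] with i hi hi0 him hip
  rw [Real.dist_eq] at hip ⊢
  have h1 := (happrox hp hi hi0).trans_lt (hbound him)
  have h2 := (happrox hp hw hw0).trans_lt (hbound (show ∫ x, w x ∂ν < C by rw [hC]; linarith))
  rw [abs_lt] at *
  constructor <;> linarith

/-- Test functions concentrated on a given interval. -/
theorem exists_testFunction {p q : ℝ} (hp : 0 ≤ p) (hpq : p < q) :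
    ∃ g : ℝ → ℝ, Continuous g ∧ (∀ y, 0 ≤ g y) ∧
      (∀ x, x ∉ Set.Ioo p q → g (Real.exp (-x)) = 0) ∧
      IntegrableOn (fun x ↦ g (Real.exp (-x)) * Real.exp (-x)) (Set.Ioi 0) ∧
      0 < ∫ x in Set.Ioi (0 : ℝ), g (Real.exp (-x)) * Real.exp (-x) := by
  -- In the variable `y = exp(-x)`, the product is positive exactly for `exp(-q) < y < exp(-p)`,
  -- that is, for `p < x < q`.
  set g : ℝ → ℝ := fun y ↦ max 0 ((y - Real.exp (-q)) * (Real.exp (-p) - y)) with hg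
  have hgc : Continuous g := by fun_prop
  have hg0 : ∀ y, 0 ≤ g y := fun y ↦ le_max_left _ _
  have hint : IntegrableOn (fun x ↦ g (Real.exp (-x)) * Real.exp (-x)) (Set.Ioi 0) := by
    obtain ⟨c, hc⟩ := isCompact_Icc.exists_bound_of_continuousOn
      (hgc.continuousOn (s := Set.Icc 0 1))
    have h1 : IntegrableOn (fun x : ℝ ↦ Real.exp (-x)) (Set.Ioi 0) := by
      simpa using exp_neg_integrableOn_Ioi 0 one_pos
    refine h1.bdd_mul (c := c) (by fun_prop) ?_
    refine (ae_restrict_iff' measurableSet_Ioi).2 (Eventually.of_forall fun x hx ↦ hc _ ?_)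
    exact ⟨(Real.exp_pos _).le, Real.exp_le_one_iff.2 (by simpa using hx.le)⟩
  refine ⟨g, hgc, hg0, ?_, hint, ?_⟩
  · intro x hx
    simp only [hg]
    apply max_eq_left
    rcases le_or_gt x p with h | h
    · have h1 : Real.exp (-p) ≤ Real.exp (-x) := Real.exp_le_exp.2 (by linarith)
      have h2 : Real.exp (-q) ≤ Real.exp (-x) := Real.exp_le_exp.2 (by linarith)
      exact mul_nonpos_of_nonneg_of_nonpos (by linarith) (by linarith)
    · have h' : q ≤ x := by
        by_contra hcon
        exact hx ⟨h, not_le.1 hcon⟩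
      have h1 : Real.exp (-x) ≤ Real.exp (-p) := Real.exp_le_exp.2 (by linarith)
      have h2 : Real.exp (-x) ≤ Real.exp (-q) := Real.exp_le_exp.2 (by linarith)
      exact mul_nonpos_of_nonpos_of_nonneg (by linarith) (by linarith)
  · rw [setIntegral_pos_iff_support_of_nonneg_ae _ hint]
    · have hsub : Set.Ioo p q ⊆
          (Function.support fun x ↦ g (Real.exp (-x)) * Real.exp (-x)) ∩ Set.Ioi 0 := by
        intro x hx
        refine ⟨?_, hp.trans_lt hx.1⟩
        have h1 : Real.exp (-x) < Real.exp (-p) := Real.exp_lt_exp.2 (by linarith [hx.1])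
        have h2 : Real.exp (-q) < Real.exp (-x) := Real.exp_lt_exp.2 (by linarith [hx.2])
        have h3 : 0 < g (Real.exp (-x)) :=
          lt_max_of_lt_right (mul_pos (by linarith) (by linarith))
        exact (mul_pos h3 (Real.exp_pos _)).ne'
      refine lt_of_lt_of_le ?_ (measure_mono hsub)
      simpa using hpq
    · exact Eventually.of_forall fun x ↦ mul_nonneg (hg0 _) (Real.exp_pos _).le

/-- Convergence of Laplace transforms of monotone densities gives pointwise convergence. -/
theorem tendsto_of_tendsto_laplace {ι : Type*} {l : Filter ι} {V : ι → ℝ → ℝ} {W : ℝ → ℝ}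
    (hV : ∀ᶠ i in l, IntegrableOn (fun x ↦ Real.exp (-x) * V i x) (Set.Ioi 0))
    (hW : IntegrableOn (fun x ↦ Real.exp (-x) * W x) (Set.Ioi 0))
    (hV0 : ∀ᶠ i in l, ∀ x, 0 < x → 0 ≤ V i x) (hW0 : ∀ x, 0 < x → 0 ≤ W x)
    (hVm : ∀ᶠ i in l, MonotoneOn (V i) (Set.Ioi 0)) (hWc : ContinuousAt W 1)
    (hmom : ∀ k : ℕ, Tendsto
      (fun i ↦ ∫ x in Set.Ioi (0 : ℝ), Real.exp (-((k + 1) * x)) * V i x) l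
      (𝓝 (∫ x in Set.Ioi (0 : ℝ), Real.exp (-((k + 1) * x)) * W x))) :
    Tendsto (fun i ↦ V i 1) l (𝓝 (W 1)) := by
  -- The Laplace transform at `k + 1` is the `k`-th moment of `exp(-x)` under the density `exp(-x) V
  -- i x`.
  have hexp : ∀ (k : ℕ) (x : ℝ), Real.exp (-((k + 1) * x)) = Real.exp (-x) ^ k * Real.exp (-x) := by
    intro k x
    rw [← Real.exp_nat_mul, ← Real.exp_add]; congr 1; ring
  have hnn : ∀ {u : ℝ → ℝ}, (∀ x, 0 < x → 0 ≤ u x) →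
      0 ≤ᵐ[volume.restrict (Set.Ioi 0)] fun x ↦ Real.exp (-x) * u x := fun hu ↦
    (ae_restrict_iff' measurableSet_Ioi).2
      (Eventually.of_forall fun x hx ↦ mul_nonneg (Real.exp_pos _).le (hu x hx))
  have htest : ∀ {g : ℝ → ℝ}, Continuous g → Tendsto
      (fun i ↦ ∫ x in Set.Ioi (0 : ℝ), g (Real.exp (-x)) * (Real.exp (-x) * V i x)) l
      (𝓝 (∫ x in Set.Ioi (0 : ℝ), g (Real.exp (-x)) * (Real.exp (-x) * W x))) := by
    intro g hg
    refine tendsto_integral_comp_of_tendsto_moments (by fun_prop) ?_ hV hW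
      (hV0.mono fun i hi ↦ hnn hi) (hnn hW0) ?_ hg
    · refine (ae_restrict_iff' measurableSet_Ioi).2 (Eventually.of_forall fun x hx ↦ ?_)
      exact ⟨(Real.exp_pos _).le, Real.exp_le_one_iff.2 (by simpa using hx.le)⟩
    · intro k
      simpa only [hexp, mul_assoc] using hmom k
  have hint : ∀ {g : ℝ → ℝ}, Continuous g → ∀ {u : ℝ → ℝ},
      IntegrableOn (fun x ↦ Real.exp (-x) * u x) (Set.Ioi 0) →
      IntegrableOn (fun x ↦ g (Real.exp (-x)) * (Real.exp (-x) * u x)) (Set.Ioi 0) := by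
    intro g hg u hu
    obtain ⟨c, hc⟩ := isCompact_Icc.exists_bound_of_continuousOn
      (hg.continuousOn (s := Set.Icc 0 1))
    refine hu.bdd_mul (c := c) (by fun_prop) ?_
    refine (ae_restrict_iff' measurableSet_Ioi).2 (Eventually.of_forall fun x hx ↦ hc _ ?_)
    exact ⟨(Real.exp_pos _).le, Real.exp_le_one_iff.2 (by simpa using hx.le)⟩
  -- comparison of a function with a constant on the support of a test function
  have hcmp_le : ∀ {g : ℝ → ℝ} {p q : ℝ}, (∀ y, 0 ≤ g y) →
      (∀ x, x ∉ Set.Ioo p q → g (Real.exp (-x)) = 0) →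
      IntegrableOn (fun x ↦ g (Real.exp (-x)) * Real.exp (-x)) (Set.Ioi 0) → Continuous g →
      ∀ {u : ℝ → ℝ} {c : ℝ}, IntegrableOn (fun x ↦ Real.exp (-x) * u x) (Set.Ioi 0) →
      (∀ x, 0 < x → x ∈ Set.Ioo p q → u x ≤ c) →
      ∫ x in Set.Ioi (0 : ℝ), g (Real.exp (-x)) * (Real.exp (-x) * u x) ≤
        c * ∫ x in Set.Ioi (0 : ℝ), g (Real.exp (-x)) * Real.exp (-x) := by
    intro g p q hg0 hgs hgi hgc u c hu huc
    rw [← integral_const_mul]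
    refine setIntegral_mono_on (hint hgc hu) (hgi.const_mul c) measurableSet_Ioi fun x hx ↦ ?_
    by_cases hxs : x ∈ Set.Ioo p q
    · have := mul_le_mul_of_nonneg_left (huc x hx hxs)
        (mul_nonneg (hg0 (Real.exp (-x))) (Real.exp_pos (-x)).le)
      linarith
    · simp [hgs x hxs]
  have hcmp_ge : ∀ {g : ℝ → ℝ} {p q : ℝ}, (∀ y, 0 ≤ g y) →
      (∀ x, x ∉ Set.Ioo p q → g (Real.exp (-x)) = 0) →
      IntegrableOn (fun x ↦ g (Real.exp (-x)) * Real.exp (-x)) (Set.Ioi 0) → Continuous g →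
      ∀ {u : ℝ → ℝ} {c : ℝ}, IntegrableOn (fun x ↦ Real.exp (-x) * u x) (Set.Ioi 0) →
      (∀ x, 0 < x → x ∈ Set.Ioo p q → c ≤ u x) →
      c * ∫ x in Set.Ioi (0 : ℝ), g (Real.exp (-x)) * Real.exp (-x) ≤
        ∫ x in Set.Ioi (0 : ℝ), g (Real.exp (-x)) * (Real.exp (-x) * u x) := by
    intro g p q hg0 hgs hgi hgc u c hu huc
    rw [← integral_const_mul]
    refine setIntegral_mono_on (hgi.const_mul c) (hint hgc hu) measurableSet_Ioi fun x hx ↦ ?_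
    by_cases hxs : x ∈ Set.Ioo p q
    · have := mul_le_mul_of_nonneg_left (huc x hx hxs)
        (mul_nonneg (hg0 (Real.exp (-x))) (Real.exp_pos (-x)).le)
      linarith
    · simp [hgs x hxs]
  refine tendsto_order.2 ⟨fun c hc ↦ ?_, fun c hc ↦ ?_⟩
  · obtain ⟨c', hcc', hc'⟩ := exists_between hc
    obtain ⟨η, hη, hball⟩ := Metric.eventually_nhds_iff.1 (hWc.eventually (lt_mem_nhds hc'))
    -- The support lies just left of `1`, where `V i x ≤ V i 1`; averaging against `g` bounds `V i
    -- 1` from below. The upper bound uses a support just right of `1`.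
    obtain ⟨g, hgc, hg0, hgs, hgi, hgpos⟩ :=
      exists_testFunction (p := max 0 (1 - η)) (q := 1) (le_max_left _ _)
        (max_lt one_pos (by linarith))
    have h1 := hcmp_ge hg0 hgs hgi hgc (c := c') hW (fun x _ hx ↦ by
      refine (hball ?_).le
      rw [Real.dist_eq, abs_lt]
      have := (le_max_right _ _).trans_lt hx.1
      constructor <;> linarith [hx.2])
    have h2 := (mul_lt_mul_of_pos_right hcc' hgpos).trans_le h1
    filter_upwards [hV, hVm, (htest hgc).eventually (lt_mem_nhds h2)] with i hi him hlt
    have h3 := hcmp_le hg0 hgs hgi hgc (c := V i 1) hi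
      (fun x hx0 hx ↦ him hx0 (Set.mem_Ioi.2 one_pos) hx.2.le)
    exact lt_of_mul_lt_mul_right (hlt.trans_le h3) hgpos.le
  · obtain ⟨c', hc', hcc'⟩ := exists_between hc
    obtain ⟨η, hη, hball⟩ := Metric.eventually_nhds_iff.1 (hWc.eventually (gt_mem_nhds hc'))
    obtain ⟨g, hgc, hg0, hgs, hgi, hgpos⟩ :=
      exists_testFunction (p := 1) (q := 1 + η) zero_le_one (by linarith)
    have h1 := hcmp_le hg0 hgs hgi hgc (c := c') hW (fun x _ hx ↦ by
      refine (hball ?_).le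
      rw [Real.dist_eq, abs_lt]
      constructor <;> linarith [hx.1, hx.2])
    have h2 := h1.trans_lt (mul_lt_mul_of_pos_right hcc' hgpos)
    filter_upwards [hV, hVm, (htest hgc).eventually (gt_mem_nhds h2)] with i hi him hlt
    have h3 := hcmp_ge hg0 hgs hgi hgc (c := V i 1) hi
      (fun x hx0 hx ↦ him (Set.mem_Ioi.2 one_pos) hx0 hx.1.le)
    exact lt_of_mul_lt_mul_right (h3.trans_lt hlt) hgpos.le

/-- A Tauberian theorem of Karamata type, for monotone densities. -/
theorem tendsto_of_laplace_regularlyVarying {U Ψ : ℝ → ℝ} (hU : MonotoneOn U (Set.Ioi 0))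
    (hU0 : ∀ x, 0 < x → 0 ≤ U x)
    (hint : ∀ r, 0 < r → IntegrableOn (fun x ↦ Real.exp (-(r * x)) * U x) (Set.Ioi 0))
    (hL : ∀ r, 0 < r → r ^ 2 * ∫ x in Set.Ioi (0 : ℝ), Real.exp (-(r * x)) * U x = Ψ r)
    {α : ℝ} (hα : α < 1) (hΨ : ∀ᶠ r in atTop, 0 < Ψ r)
    (hreg : ∀ c : ℝ, 0 < c → Tendsto (fun r ↦ Ψ (c * r) / Ψ r) atTop (𝓝 (c ^ α))) :
    Tendsto (fun r ↦ r * U (1 / r) / Ψ r) atTop (𝓝 (1 / Real.Gamma (2 - α))) := by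
  have hΓ : 0 < Real.Gamma (2 - α) := Real.Gamma_pos_of_pos (by linarith)
  set W : ℝ → ℝ := fun x ↦ x ^ (1 - α) / Real.Gamma (2 - α) with hW
  -- With this scaling the transform of `V r` at `k + 1` is `Ψ((k+1) r) / Ψ(r) / (k+1)²`, so regular
  -- variation identifies its limit with the transform of `W`.
  set V : ℝ → ℝ → ℝ := fun r x ↦ r / Ψ r * U (r⁻¹ * x) with hV
  have hmain : Tendsto (fun r ↦ V r 1) atTop (𝓝 (W 1)) := by
    apply tendsto_of_tendsto_laplace
    · filter_upwards [eventually_gt_atTop 0] with r hr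
      have h1 := (integrableOn_Ioi_comp_mul_left_iff (fun x ↦ Real.exp (-(r * x)) * U x) 0
        (inv_pos.2 hr)).2 (by simpa using hint r hr)
      have h2 := h1.const_mul (r / Ψ r)
      refine h2.congr (Eventually.of_forall fun x ↦ ?_)
      simp only [hV]
      rw [mul_inv_cancel_left₀ hr.ne']; ring
    · have := (Real.GammaIntegral_convergent (s := 2 - α) (by linarith)).div_const
        (Real.Gamma (2 - α))
      refine this.congr (Eventually.of_forall fun x ↦ ?_)
      simp only [hW]
      rw [show 2 - α - 1 = 1 - α by ring]; ring
    · filter_upwards [eventually_gt_atTop 0, hΨ] with r hr hr' x hx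
      exact mul_nonneg (div_pos hr hr').le (hU0 _ (by positivity))
    · intro x hx; positivity
    · filter_upwards [eventually_gt_atTop 0, hΨ] with r hr hr' x hx y hy hxy
      simp only [Set.mem_Ioi] at hx hy
      refine mul_le_mul_of_nonneg_left (hU (Set.mem_Ioi.2 (by positivity))
        (Set.mem_Ioi.2 (by positivity)) (by gcongr)) (div_pos hr hr').le
    · exact (Real.continuousAt_rpow_const _ _ (Or.inl one_ne_zero)).div_const _
    · intro k
      have hk : (0 : ℝ) < (k : ℝ) + 1 := by positivity
      have hlim : ∫ x in Set.Ioi (0 : ℝ), Real.exp (-((k + 1) * x)) * W x =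
          ((k : ℝ) + 1) ^ α / ((k : ℝ) + 1) ^ 2 := by
        have h1 := Real.integral_rpow_mul_exp_neg_mul_Ioi (a := 2 - α) (by linarith) hk
        have h2 : ∀ x : ℝ, Real.exp (-((k + 1) * x)) * W x =
            (x ^ (2 - α - 1) * Real.exp (-((k + 1) * x))) / Real.Gamma (2 - α) := by
          intro x
          simp only [hW]
          rw [show 2 - α - 1 = 1 - α by ring]; ring
        simp_rw [h2]
        rw [integral_div, h1, mul_div_cancel_right₀ _ hΓ.ne', one_div, Real.inv_rpow hk.le,
          ← Real.rpow_neg hk.le, neg_sub, Real.rpow_sub hk]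
        norm_cast
      rw [hlim]
      refine ((hreg _ hk).div_const (((k : ℝ) + 1) ^ 2)).congr' ?_
      filter_upwards [eventually_gt_atTop 0, hΨ] with r hr hr'
      have hkr : 0 < ((k : ℝ) + 1) * r := by positivity
      have h1 := integral_comp_mul_left_Ioi
        (fun x ↦ Real.exp (-(((k + 1) * r) * x)) * U x) 0 (inv_pos.2 hr)
      have h2 : ∀ x : ℝ, Real.exp (-((k + 1) * x)) * V r x =
          r / Ψ r * (Real.exp (-(((k + 1) * r) * (r⁻¹ * x))) * U (r⁻¹ * x)) := by
        intro x
        simp only [hV]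
        rw [show ((k : ℝ) + 1) * r * (r⁻¹ * x) = (k + 1) * x by field_simp]; ring
      simp_rw [h2]
      rw [integral_const_mul, h1, mul_zero, inv_inv, smul_eq_mul, ← hL _ hkr]
      field_simp
  simp only [hV, hW, Real.one_rpow, mul_one] at hmain
  refine hmain.congr fun r ↦ ?_
  rw [one_div]; ring

/-! ### The kernel identity and Laplace transforms of a subordinator. -/

/-- `1 - exp (-r x)` as a Laplace integral of the truncations `min x δ`. -/
theorem lintegral_exp_mul_min {r x : ℝ} (hr : 0 < r) (hx : 0 ≤ x) :
    ∫⁻ δ in Set.Ioi (0 : ℝ), ENNReal.ofReal (r ^ 2 * Real.exp (-(r * δ)) * min x δ) =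
      ENNReal.ofReal (1 - Real.exp (-(r * x))) := by
  have hderiv : ∀ y : ℝ, HasDerivAt (fun y ↦ -(r * y + 1) * Real.exp (-(r * y)))
      (r ^ 2 * Real.exp (-(r * y)) * y) y := by
    intro y
    have h1 : HasDerivAt (fun y : ℝ ↦ -(r * y + 1)) (-(r * 1)) y :=
      (((hasDerivAt_id y).const_mul r).add_const 1).neg
    have h2 : HasDerivAt (fun y : ℝ ↦ -(r * y)) (-(r * 1)) y :=
      ((hasDerivAt_id y).const_mul r).neg
    refine (h1.mul h2.exp).congr_deriv ?_
    ring
  have hcont : Continuous fun y : ℝ ↦ r ^ 2 * Real.exp (-(r * y)) * y := by fun_prop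
  -- The integral is split at `x`, where `min x y` changes from `y` to `x`.
  have hA : ∫ y in Set.Ioc 0 x, r ^ 2 * Real.exp (-(r * y)) * min x y =
      1 - (r * x + 1) * Real.exp (-(r * x)) := by
    have h1 := intervalIntegral.integral_eq_sub_of_hasDerivAt (a := 0) (b := x)
      (fun y _ ↦ hderiv y) (hcont.intervalIntegrable _ _)
    rw [intervalIntegral.integral_of_le hx] at h1
    rw [setIntegral_congr_fun (g := fun y ↦ r ^ 2 * Real.exp (-(r * y)) * y) measurableSet_Ioc
      (fun y hy ↦ by simp only [min_eq_right hy.2]), h1]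
    simp; ring
  have hexp : IntegrableOn (fun y ↦ Real.exp (-(r * y))) (Set.Ioi x) := by
    simpa using exp_neg_integrableOn_Ioi x hr
  have hcongr : Set.EqOn (fun y ↦ r ^ 2 * Real.exp (-(r * y)) * min x y)
      (fun y ↦ r ^ 2 * x * Real.exp (-(r * y))) (Set.Ioi x) := fun y hy ↦ by
    simp only [min_eq_left (Set.mem_Ioi.1 hy).le]; ring
  have hB : ∫ y in Set.Ioi x, r ^ 2 * Real.exp (-(r * y)) * min x y =
      r * x * Real.exp (-(r * x)) := by
    rw [setIntegral_congr_fun measurableSet_Ioi hcongr, integral_const_mul]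
    have := integral_exp_mul_Ioi (a := -r) (by linarith) x
    simp only [neg_mul] at this
    rw [this]
    field_simp
  have hIA : IntegrableOn (fun y ↦ r ^ 2 * Real.exp (-(r * y)) * min x y) (Set.Ioc 0 x) :=
    (Continuous.integrableOn_Icc (by fun_prop)).mono_set Set.Ioc_subset_Icc_self
  have hIB : IntegrableOn (fun y ↦ r ^ 2 * Real.exp (-(r * y)) * min x y) (Set.Ioi x) :=
    (integrableOn_congr_fun hcongr measurableSet_Ioi).2 (hexp.const_mul _)
  rw [← ofReal_integral_eq_lintegral_ofReal, ← Set.Ioc_union_Ioi_eq_Ioi hx,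
    setIntegral_union (Set.Ioc_disjoint_Ioi le_rfl) measurableSet_Ioi hIA hIB, hA, hB]
  · congr 1; ring
  · rw [← Set.Ioc_union_Ioi_eq_Ioi hx]; exact hIA.union hIB
  · refine (ae_restrict_iff' measurableSet_Ioi).2 (Eventually.of_forall fun y hy ↦ ?_)
    have : 0 ≤ min x y := le_min hx (Set.mem_Ioi.1 hy).le
    simp only [Pi.zero_apply]
    positivity

namespace IsSubordinator

variable {Ω : Type*} [MeasurableSpace Ω] {P : Measure Ω} {X : ℝ≥0 → Ω → ℝ}

theorem nonneg (hX : IsSubordinator X P) : ∀ᵐ ω ∂P, ∀ t, 0 ≤ X t ω := by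
  filter_upwards [hX.zero, hX.mono] with ω h0 hm t
  rw [← h0]
  exact hm zero_le

theorem laplace_add (hX : IsSubordinator X P) (u : ℝ) (s h : ℝ≥0) :
    ∫ ω, Real.exp (-u * X (s + h) ω) ∂P =
      (∫ ω, Real.exp (-u * X s ω) ∂P) * ∫ ω, Real.exp (-u * X h ω) ∂P := by
  have hind := hX.indep.indepFun_eval_sub zero_le (le_self_add : s ≤ s + h) hX.zero
  have hφ : Measurable fun x : ℝ ↦ Real.exp (-u * x) := by fun_prop
  have h1 := (hind.comp hφ hφ).integral_mul_eq_mul_integral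
    (hφ.comp (hX.measurable s)).aestronglyMeasurable
    (hφ.comp ((hX.measurable (s + h)).sub (hX.measurable s))).aestronglyMeasurable
  have h2 := ((hX.stationary s h).comp hφ).integral_eq
  simp only [Function.comp_def, Pi.mul_def, Pi.sub_apply, ← Real.exp_add] at h1 h2
  rw [h2] at h1
  rw [← h1]
  refine integral_congr_ae (Eventually.of_forall fun ω ↦ ?_)
  simp only
  congr 1; ring

variable [IsProbabilityMeasure P]

theorem integrable_exp (hX : IsSubordinator X P) {u : ℝ} (hu : 0 ≤ u) (t : ℝ≥0) :
    Integrable (fun ω ↦ Real.exp (-u * X t ω)) P := by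
  have hm := hX.measurable t
  refine Integrable.of_bound (C := 1) (by fun_prop) ?_
  filter_upwards [hX.nonneg] with ω h
  rw [Real.norm_eq_abs, abs_of_pos (Real.exp_pos _), Real.exp_le_one_iff]
  have := mul_nonneg hu (h t)
  linarith

theorem laplace_pos (hX : IsSubordinator X P) {u : ℝ} (hu : 0 ≤ u) (t : ℝ≥0) :
    0 < ∫ ω, Real.exp (-u * X t ω) ∂P :=
  integral_exp_pos (hX.integrable_exp hu t)

theorem laplace_zero (hX : IsSubordinator X P) (u : ℝ) :
    ∫ ω, Real.exp (-u * X 0 ω) ∂P = 1 := by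
  have : ∫ ω, Real.exp (-u * X 0 ω) ∂P = ∫ _, (1 : ℝ) ∂P := integral_congr_ae (by
    filter_upwards [hX.zero] with ω h
    simp [h])
  simpa using this

theorem laplace_nat_mul (hX : IsSubordinator X P) (u : ℝ) (n : ℕ) (s : ℝ≥0) :
    ∫ ω, Real.exp (-u * X (n * s) ω) ∂P = (∫ ω, Real.exp (-u * X s ω) ∂P) ^ n := by
  induction n with
  | zero => simpa using hX.laplace_zero u
  | succ n ih =>
    rw [pow_succ, ← ih, ← hX.laplace_add]
    push_cast
    rw [add_mul, one_mul]

/-- The `b`-th power of the transform at time `s = a/b` is the `a`-th power of the transform at time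
`1`, and positive `b`-th roots are unique. Restricting to rational times avoids any continuity
argument in time. -/
theorem laplace_eq_exp (hX : IsSubordinator X P) {u : ℝ} (hu : 0 ≤ u) {a b : ℕ} (hb : b ≠ 0)
    {s : ℝ≥0} (hs : b * s = a) :
    ∫ ω, Real.exp (-u * X s ω) ∂P = Real.exp (-(s * laplaceExponent X P u)) := by
  have h1 : Real.exp (-laplaceExponent X P u) = ∫ ω, Real.exp (-u * X 1 ω) ∂P := by
    rw [laplaceExponent, neg_neg, Real.exp_log (hX.laplace_pos hu 1)]
  have h2 := hX.laplace_nat_mul u b s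
  have h3 := hX.laplace_nat_mul u a 1
  rw [mul_one] at h3
  rw [hs, h3, ← h1, ← Real.exp_nat_mul] at h2
  refine (pow_left_inj₀ (hX.laplace_pos hu s).le (Real.exp_pos _).le hb).1 ?_
  rw [← h2, ← Real.exp_nat_mul]
  have : (b : ℝ) * s = a := by exact_mod_cast hs
  rw [← this]
  congr 1; ring

end IsSubordinator

/-! ### Truncated means and their Laplace transform. -/

/-- The truncated mean `2ⁿ E[min(X_{t / 2ⁿ}, δ)]`. -/
noncomputable def dyadicTruncMean {Ω : Type*} [MeasurableSpace Ω] (X : ℝ≥0 → Ω → ℝ)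
    (P : Measure Ω) (t : ℝ≥0) (n : ℕ) (δ : ℝ) : ℝ :=
  2 ^ n * ∫ ω, min (X (t / 2 ^ n) ω) δ ∂P

/-- The supremum over `n` of the truncated means `2ⁿ E[min(X_{t / 2ⁿ}, δ)]`; it is the mean of the
process of `δ`-shortened jumps at time `t`. -/
noncomputable def truncMean {Ω : Type*} [MeasurableSpace Ω] (X : ℝ≥0 → Ω → ℝ)
    (P : Measure Ω) (t : ℝ≥0) (δ : ℝ) : ℝ :=
  ⨆ n, dyadicTruncMean X P t n δ

theorem tendsto_two_pow_mul_one_sub_exp (c : ℝ) :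
    Tendsto (fun n : ℕ ↦ (2 : ℝ) ^ n * (1 - Real.exp (-(c / 2 ^ n)))) atTop (𝓝 c) := by
  have hd : HasDerivAt (fun x : ℝ ↦ 1 - Real.exp (-(c * x))) c 0 := by
    have h1 : HasDerivAt (fun x : ℝ ↦ -(c * x)) (-(c * 1)) 0 :=
      ((hasDerivAt_id (0 : ℝ)).const_mul c).neg
    refine (h1.exp.const_sub 1).congr_deriv ?_
    simp
  have hlim : Tendsto (fun n : ℕ ↦ ((2 : ℝ) ^ n)⁻¹) atTop (𝓝[≠] 0) := by
    refine tendsto_nhdsWithin_iff.2 ⟨?_, Eventually.of_forall fun n ↦ by simp⟩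
    exact (tendsto_pow_atTop_atTop_of_one_lt one_lt_two).inv_tendsto_atTop
  have := (hasDerivAt_iff_tendsto_slope_zero.1 hd).comp hlim
  refine this.congr fun n ↦ ?_
  simp [div_eq_mul_inv]

/-- For `x ≤ δ` the chord of `exp` over `[-1, 0]` gives the bound; for `x ≥ δ` monotonicity of `exp`
does. It controls truncated means by the Laplace exponent at `1/δ`. -/
theorem one_sub_exp_mul_min_le {x δ : ℝ} (hδ : 0 < δ) (hx : 0 ≤ x) :
    (1 - Real.exp (-1)) * min x δ ≤ δ * (1 - Real.exp (-((1 / δ) * x))) := by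
  have he : Real.exp (-1) < 1 := by
    rw [Real.exp_lt_one_iff]; norm_num
  rcases le_total x δ with h | h
  · rw [min_eq_left h]
    have hs0 : 0 ≤ x / δ := by positivity
    have hs1 : x / δ ≤ 1 := by rwa [div_le_one hδ]
    have hc := convexOn_exp.2 (Set.mem_univ (0 : ℝ)) (Set.mem_univ (-1 : ℝ))
      (sub_nonneg.2 hs1) hs0 (by ring)
    simp only [smul_eq_mul, mul_zero, Real.exp_zero, mul_one, zero_add, mul_neg] at hc
    have h1 : x = δ * (x / δ) := by field_simp
    rw [show (1 / δ) * x = x / δ by ring]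
    calc (1 - Real.exp (-1)) * x = δ * ((1 - Real.exp (-1)) * (x / δ)) := by
          rw [mul_left_comm, ← h1]
      _ ≤ _ := mul_le_mul_of_nonneg_left (by linarith) hδ.le
  · rw [min_eq_right h, mul_comm]
    refine mul_le_mul_of_nonneg_left ?_ hδ.le
    have : 1 ≤ (1 / δ) * x := by rw [one_div_mul_eq_div, one_le_div hδ]; exact h
    have := Real.exp_le_exp.2 (neg_le_neg this)
    linarith

namespace IsSubordinator

variable {Ω : Type*} [MeasurableSpace Ω] {P : Measure Ω} {X : ℝ≥0 → Ω → ℝ}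

theorem dyadicTruncMean_nonneg (hX : IsSubordinator X P) (t : ℝ≥0) (n : ℕ) {δ : ℝ} (hδ : 0 < δ) :
    0 ≤ dyadicTruncMean X P t n δ := by
  refine mul_nonneg (by positivity) (integral_nonneg_of_ae ?_)
  filter_upwards [hX.nonneg] with ω h
  exact le_min (h _) hδ.le

variable [IsProbabilityMeasure P]

theorem integrable_min (hX : IsSubordinator X P) (h : ℝ≥0) {δ : ℝ} (hδ : 0 < δ) :
    Integrable (fun ω ↦ min (X h ω) δ) P := by
  have hm := hX.measurable h
  refine Integrable.of_bound (C := δ) (by fun_prop) ?_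
  filter_upwards [hX.nonneg] with ω h
  rw [Real.norm_eq_abs, abs_of_nonneg (le_min (h _) hδ.le)]
  exact min_le_right _ _

theorem dyadicTruncMean_mono_size (hX : IsSubordinator X P) (t : ℝ≥0) (n : ℕ) {δ ε : ℝ}
    (hδ : 0 < δ) (h : δ ≤ ε) : dyadicTruncMean X P t n δ ≤ dyadicTruncMean X P t n ε := by
  refine mul_le_mul_of_nonneg_left ?_ (by positivity)
  exact integral_mono (hX.integrable_min _ hδ) (hX.integrable_min _ (hδ.trans_le h))
    fun ω ↦ min_le_min le_rfl h

theorem dyadicTruncMean_div_anti_size (hX : IsSubordinator X P) (t : ℝ≥0) (n : ℕ) {δ ε : ℝ}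
    (hδ : 0 < δ) (h : δ ≤ ε) :
    dyadicTruncMean X P t n ε / ε ≤ dyadicTruncMean X P t n δ / δ := by
  have hε := hδ.trans_le h
  rw [dyadicTruncMean, dyadicTruncMean, mul_div_assoc, mul_div_assoc, ← integral_div,
    ← integral_div]
  refine mul_le_mul_of_nonneg_left ?_ (by positivity)
  refine integral_mono_ae ((hX.integrable_min _ hε).div_const _)
    ((hX.integrable_min _ hδ).div_const _) ?_
  filter_upwards [hX.nonneg] with ω hω
  rw [← min_div_div_right hε.le, ← min_div_div_right hδ.le, div_self hε.ne', div_self hδ.ne']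
  exact min_le_min (div_le_div_of_nonneg_left (hω _) hδ h) le_rfl

/-- Truncation `min(·, δ)` is subadditive on nonnegative numbers, and both halves of a dyadic
interval have increments of the same law, so halving cannot decrease the total. -/
theorem monotone_dyadicTruncMean (hX : IsSubordinator X P) (t : ℝ≥0) {δ : ℝ} (hδ : 0 < δ) :
    Monotone fun n ↦ dyadicTruncMean X P t n δ := by
  refine monotone_nat_of_le_succ fun n ↦ ?_
  set h := t / 2 ^ (n + 1) with hh
  have h2 : t / 2 ^ n = h + h := by rw [hh, pow_succ]; field_simp; norm_num
  have hid : Integrable (fun ω ↦ min (X (h + h) ω - X h ω) δ) P ∧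
      ∫ ω, min (X (h + h) ω - X h ω) δ ∂P = ∫ ω, min (X h ω) δ ∂P := by
    have := (hX.stationary h h).comp (u := fun x ↦ min x δ) (by fun_prop)
    exact ⟨this.integrable_iff.2 (hX.integrable_min h hδ), this.integral_eq⟩
  have hle : ∫ ω, min (X (h + h) ω) δ ∂P ≤
      ∫ ω, min (X (h + h) ω - X h ω) δ ∂P + ∫ ω, min (X h ω) δ ∂P := by
    rw [← integral_add hid.1 (hX.integrable_min h hδ)]
    refine integral_mono_ae (hX.integrable_min _ hδ) (hid.1.add (hX.integrable_min h hδ)) ?_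
    filter_upwards [hX.nonneg, hX.mono] with ω hω hm
    have h1 := hω h
    have h3 : X h ω ≤ X (h + h) ω := hm le_self_add
    rcases min_cases (X (h + h) ω - X h ω) δ with ⟨e1, _⟩ | ⟨e1, _⟩ <;>
    rcases min_cases (X h ω) δ with ⟨e2, _⟩ | ⟨e2, _⟩ <;>
    rcases min_cases (X (h + h) ω) δ with ⟨e3, _⟩ | ⟨e3, _⟩ <;> rw [e1, e2, e3] <;> linarith
  rw [hid.2] at hle
  rw [dyadicTruncMean, dyadicTruncMean, ← hh, h2, pow_succ, mul_assoc]
  exact mul_le_mul_of_nonneg_left (by linarith) (by positivity)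

variable {a b : ℕ} {t : ℝ≥0}

theorem laplace_div_two_pow (hX : IsSubordinator X P) (hb : b ≠ 0) (ht : b * t = a)
    {u : ℝ} (hu : 0 ≤ u) (n : ℕ) :
    ∫ ω, Real.exp (-u * X (t / 2 ^ n) ω) ∂P =
      Real.exp (-(t * laplaceExponent X P u / 2 ^ n)) := by
  rw [hX.laplace_eq_exp hu (a := a) (b := b * 2 ^ n) (by positivity)
    (by rw [← ht]; push_cast; field_simp)]
  congr 1
  push_cast
  ring

/-- The bound is uniform in `n`, which makes the supremum `truncMean` a genuine limit rather than
the default value `0` of an unbounded real supremum. -/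
theorem dyadicTruncMean_le (hX : IsSubordinator X P) (hb : b ≠ 0) (ht : b * t = a)
    {δ : ℝ} (hδ : 0 < δ) (n : ℕ) :
    dyadicTruncMean X P t n δ ≤
      δ * (t * laplaceExponent X P (1 / δ)) / (1 - Real.exp (-1)) := by
  have he : 0 < 1 - Real.exp (-1) := by
    rw [sub_pos, Real.exp_lt_one_iff]; norm_num
  have hu : 0 ≤ 1 / δ := by positivity
  rw [le_div_iff₀ he]
  have h1 : (1 - Real.exp (-1)) * ∫ ω, min (X (t / 2 ^ n) ω) δ ∂P ≤
      δ * (1 - ∫ ω, Real.exp (-(1 / δ) * X (t / 2 ^ n) ω) ∂P) := by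
    have h2 : (1 : ℝ) - ∫ ω, Real.exp (-(1 / δ) * X (t / 2 ^ n) ω) ∂P =
        ∫ ω, (1 - Real.exp (-(1 / δ) * X (t / 2 ^ n) ω)) ∂P := by
      rw [integral_sub (integrable_const _) (hX.integrable_exp hu _)]
      simp
    rw [h2, ← integral_const_mul, ← integral_const_mul]
    refine integral_mono_ae ((hX.integrable_min _ hδ).const_mul _)
      (((integrable_const _).sub (hX.integrable_exp hu _)).const_mul _) ?_
    filter_upwards [hX.nonneg] with ω hω
    have := one_sub_exp_mul_min_le hδ (hω (t / 2 ^ n))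
    rwa [← neg_mul] at this
  rw [hX.laplace_div_two_pow hb ht hu] at h1
  have h3 : 1 - Real.exp (-(t * laplaceExponent X P (1 / δ) / 2 ^ n)) ≤
      t * laplaceExponent X P (1 / δ) / 2 ^ n := by
    have := Real.add_one_le_exp (-(t * laplaceExponent X P (1 / δ) / 2 ^ n))
    linarith
  have h4 := h1.trans (mul_le_mul_of_nonneg_left h3 hδ.le)
  have h5 := mul_le_mul_of_nonneg_left h4 (by positivity : (0 : ℝ) ≤ 2 ^ n)
  rw [dyadicTruncMean]
  calc _ = 2 ^ n * ((1 - Real.exp (-1)) * ∫ ω, min (X (t / 2 ^ n) ω) δ ∂P) := by ring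
    _ ≤ _ := h5
    _ = _ := by field_simp

theorem tendsto_dyadicTruncMean (hX : IsSubordinator X P) (hb : b ≠ 0) (ht : b * t = a)
    {δ : ℝ} (hδ : 0 < δ) :
    Tendsto (fun n ↦ dyadicTruncMean X P t n δ) atTop (𝓝 (truncMean X P t δ)) :=
  tendsto_atTop_ciSup (hX.monotone_dyadicTruncMean t hδ)
    ⟨_, Set.forall_mem_range.2 fun n ↦ hX.dyadicTruncMean_le hb ht hδ n⟩

theorem dyadicTruncMean_le_truncMean (hX : IsSubordinator X P) (hb : b ≠ 0) (ht : b * t = a)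
    {δ : ℝ} (hδ : 0 < δ) (n : ℕ) : dyadicTruncMean X P t n δ ≤ truncMean X P t δ :=
  (hX.monotone_dyadicTruncMean t hδ).ge_of_tendsto (hX.tendsto_dyadicTruncMean hb ht hδ) n

theorem truncMean_nonneg (hX : IsSubordinator X P) (hb : b ≠ 0) (ht : b * t = a)
    {δ : ℝ} (hδ : 0 < δ) : 0 ≤ truncMean X P t δ :=
  (hX.dyadicTruncMean_nonneg t 0 hδ).trans (hX.dyadicTruncMean_le_truncMean hb ht hδ 0)

theorem monotoneOn_truncMean (hX : IsSubordinator X P) (hb : b ≠ 0) (ht : b * t = a) :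
    MonotoneOn (truncMean X P t) (Set.Ioi 0) := fun _ hδ _ hε h ↦
  le_of_tendsto_of_tendsto' (hX.tendsto_dyadicTruncMean hb ht hδ)
    (hX.tendsto_dyadicTruncMean hb ht hε) fun n ↦ hX.dyadicTruncMean_mono_size t n hδ h

theorem truncMean_div_anti_size (hX : IsSubordinator X P) (hb : b ≠ 0) (ht : b * t = a)
    {δ ε : ℝ} (hδ : 0 < δ) (h : δ ≤ ε) :
    truncMean X P t ε / ε ≤ truncMean X P t δ / δ :=
  le_of_tendsto_of_tendsto' ((hX.tendsto_dyadicTruncMean hb ht (hδ.trans_le h)).div_const _)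
    ((hX.tendsto_dyadicTruncMean hb ht hδ).div_const _)
    fun n ↦ hX.dyadicTruncMean_div_anti_size t n hδ h

/-- Tonelli's theorem exchanges `δ` and `ω`, and the kernel identity evaluates the inner integral.
-/
theorem lintegral_dyadicTruncMean (hX : IsSubordinator X P) (hb : b ≠ 0) (ht : b * t = a)
    {r : ℝ} (hr : 0 < r) (n : ℕ) :
    ∫⁻ δ in Set.Ioi (0 : ℝ),
        ENNReal.ofReal (r ^ 2 * Real.exp (-(r * δ)) * dyadicTruncMean X P t n δ) =
      ENNReal.ofReal (2 ^ n * (1 - Real.exp (-(t * laplaceExponent X P r / 2 ^ n)))) := by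
  have hm := hX.measurable (t / 2 ^ n)
  have h1 : ∀ δ ∈ Set.Ioi (0 : ℝ),
      ENNReal.ofReal (r ^ 2 * Real.exp (-(r * δ)) * dyadicTruncMean X P t n δ) =
        ENNReal.ofReal (2 ^ n) * ∫⁻ ω, ENNReal.ofReal
          (r ^ 2 * Real.exp (-(r * δ)) * min (X (t / 2 ^ n) ω) δ) ∂P := by
    intro δ hδ
    rw [← ofReal_integral_eq_lintegral_ofReal ((hX.integrable_min _ hδ).const_mul _),
      ← ENNReal.ofReal_mul (by positivity), integral_const_mul, dyadicTruncMean]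
    · congr 1; ring
    · filter_upwards [hX.nonneg] with ω hω
      have : 0 ≤ min (X (t / 2 ^ n) ω) δ := le_min (hω _) (Set.mem_Ioi.1 hδ).le
      simp only [Pi.zero_apply]
      positivity
  rw [setLIntegral_congr_fun measurableSet_Ioi h1, lintegral_const_mul' _ _ ENNReal.ofReal_ne_top,
    lintegral_lintegral_swap]
  · have h2 : ∫⁻ ω, (∫⁻ δ in Set.Ioi (0 : ℝ), ENNReal.ofReal
        (r ^ 2 * Real.exp (-(r * δ)) * min (X (t / 2 ^ n) ω) δ)) ∂P =
        ∫⁻ ω, ENNReal.ofReal (1 - Real.exp (-r * X (t / 2 ^ n) ω)) ∂P := by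
      refine lintegral_congr_ae ?_
      filter_upwards [hX.nonneg] with ω hω
      rw [lintegral_exp_mul_min hr (hω _), neg_mul]
    rw [h2, ← ofReal_integral_eq_lintegral_ofReal, ← ENNReal.ofReal_mul (by positivity),
      integral_sub (integrable_const _) (hX.integrable_exp hr.le _),
      hX.laplace_div_two_pow hb ht hr.le]
    · simp
    · exact (integrable_const _).sub (hX.integrable_exp hr.le _)
    · filter_upwards [hX.nonneg] with ω hω
      simp only [Pi.zero_apply, sub_nonneg, Real.exp_le_one_iff]
      have := mul_nonneg hr.le (hω (t / 2 ^ n))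
      linarith
  · have : Measurable fun p : ℝ × Ω ↦ X (t / 2 ^ n) p.2 := hm.comp measurable_snd
    simp only [Function.uncurry_def]
    fun_prop

theorem lintegral_truncMean (hX : IsSubordinator X P) (hb : b ≠ 0) (ht : b * t = a)
    {r : ℝ} (hr : 0 < r) :
    ∫⁻ δ in Set.Ioi (0 : ℝ), ENNReal.ofReal (r ^ 2 * Real.exp (-(r * δ)) * truncMean X P t δ) =
      ENNReal.ofReal (t * laplaceExponent X P r) := by
  have hmono : ∀ n, MonotoneOn (dyadicTruncMean X P t n) (Set.Ioi 0) := fun n δ hδ ε _ h ↦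
    hX.dyadicTruncMean_mono_size t n hδ h
  have h1 : Tendsto (fun n ↦ ∫⁻ δ in Set.Ioi (0 : ℝ),
      ENNReal.ofReal (r ^ 2 * Real.exp (-(r * δ)) * dyadicTruncMean X P t n δ)) atTop
      (𝓝 (∫⁻ δ in Set.Ioi (0 : ℝ),
        ENNReal.ofReal (r ^ 2 * Real.exp (-(r * δ)) * truncMean X P t δ))) := by
    refine lintegral_tendsto_of_tendsto_of_monotone (fun n ↦ ?_) ?_ ?_
    · have := aemeasurable_restrict_of_monotoneOn (μ := volume) measurableSet_Ioi (hmono n)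
      fun_prop
    · refine (ae_restrict_iff' measurableSet_Ioi).2 (Eventually.of_forall fun δ hδ m n hmn ↦ ?_)
      have := hX.monotone_dyadicTruncMean t hδ hmn
      simp only at this ⊢
      gcongr
    · refine (ae_restrict_iff' measurableSet_Ioi).2 (Eventually.of_forall fun δ hδ ↦ ?_)
      exact ENNReal.tendsto_ofReal ((hX.tendsto_dyadicTruncMean hb ht hδ).const_mul _)
  simp_rw [hX.lintegral_dyadicTruncMean hb ht hr] at h1
  exact tendsto_nhds_unique h1
    (ENNReal.tendsto_ofReal (tendsto_two_pow_mul_one_sub_exp (t * laplaceExponent X P r)))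

theorem laplaceExponent_nonneg (hX : IsSubordinator X P) {u : ℝ} (hu : 0 ≤ u) :
    0 ≤ laplaceExponent X P u := by
  rw [laplaceExponent, neg_nonneg]
  refine Real.log_nonpos (hX.laplace_pos hu 1).le ?_
  have : ∫ ω, Real.exp (-u * X 1 ω) ∂P ≤ ∫ _, (1 : ℝ) ∂P := by
    refine integral_mono_ae (hX.integrable_exp hu 1) (integrable_const _) ?_
    filter_upwards [hX.nonneg] with ω hω
    rw [Real.exp_le_one_iff]
    have := mul_nonneg hu (hω 1)
    linarith
  simpa using this

/-- The Laplace transform of the truncated mean. -/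
theorem integrableOn_and_laplace_truncMean (hX : IsSubordinator X P) (hb : b ≠ 0)
    (ht : b * t = a) {r : ℝ} (hr : 0 < r) :
    IntegrableOn (fun δ ↦ Real.exp (-(r * δ)) * truncMean X P t δ) (Set.Ioi 0) ∧
      r ^ 2 * ∫ δ in Set.Ioi (0 : ℝ), Real.exp (-(r * δ)) * truncMean X P t δ =
        t * laplaceExponent X P r := by
  have h := hX.lintegral_truncMean hb ht hr
  have hnn : 0 ≤ᵐ[volume.restrict (Set.Ioi 0)]
      fun δ ↦ r ^ 2 * Real.exp (-(r * δ)) * truncMean X P t δ := by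
    refine (ae_restrict_iff' measurableSet_Ioi).2 (Eventually.of_forall fun δ hδ ↦ ?_)
    have := hX.truncMean_nonneg hb ht hδ
    simp only [Pi.zero_apply]
    positivity
  have hmeas : AEStronglyMeasurable (fun δ ↦ r ^ 2 * Real.exp (-(r * δ)) * truncMean X P t δ)
      (volume.restrict (Set.Ioi 0)) := by
    have := aemeasurable_restrict_of_monotoneOn (μ := volume) measurableSet_Ioi
      (hX.monotoneOn_truncMean hb ht)
    exact AEMeasurable.aestronglyMeasurable (by fun_prop)
  constructor
  · have hI : IntegrableOn (fun δ ↦ r ^ 2 * Real.exp (-(r * δ)) * truncMean X P t δ)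
        (Set.Ioi 0) := by
      refine (lintegral_ofReal_ne_top_iff_integrable hmeas hnn).1 ?_
      rw [h]
      exact ENNReal.ofReal_ne_top
    refine (hI.const_mul (r ^ 2)⁻¹).congr (Eventually.of_forall fun δ ↦ ?_)
    simp only
    field_simp
  · rw [← integral_const_mul]
    simp_rw [← mul_assoc]
    rw [integral_eq_lintegral_of_nonneg_ae hnn hmeas, h]
    exact ENNReal.toReal_ofReal (mul_nonneg t.2 (hX.laplaceExponent_nonneg hr.le))

end IsSubordinator

/-! ### Second moments and almost sure concentration along sequences. -/

namespace IsSubordinator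

variable {Ω : Type*} [MeasurableSpace Ω] {P : Measure Ω} {X : ℝ≥0 → Ω → ℝ}

theorem ae_isPath (hX : IsSubordinator X P) : ∀ᵐ ω ∂P, X 0 ω = 0 ∧ Monotone (fun t ↦ X t ω) ∧
    ∀ t, ContinuousWithinAt (fun s ↦ X s ω) (Set.Ici t) t := by
  filter_upwards [hX.zero, hX.mono, hX.rightCont] with ω h0 hm hc using ⟨h0, hm, hc⟩

theorem aemeasurable_shortenedCount (hX : IsSubordinator X P) {t : ℝ≥0} (ht : 0 < t) {δ : ℝ}
    (hδ : 0 < δ) : AEMeasurable (shortenedCount X t δ) P := by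
  refine aemeasurable_of_tendsto_metrizable_ae atTop (f := fun (n : ℕ) ω ↦
    ∑ k ∈ Finset.range (2 ^ n),
      min ((X ((k + 1 : ℕ) * (t / 2 ^ n)) ω - X (k * (t / 2 ^ n)) ω) / δ) 1) (fun n ↦ ?_) ?_
  · have hm := hX.measurable
    fun_prop
  · filter_upwards [hX.ae_isPath] with ω hω
    exact tendsto_sum_min_increments hω.2.1 hω.2.2 hω.1 hδ ht

variable [IsProbabilityMeasure P] {a b : ℕ} {t : ℝ≥0}

/-- The summands `D k` are independent with values in `[0, 1]` almost surely, so `D² ≤ D` bounds the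
variance of the sum by its mean. -/
theorem lintegral_sq_sum_min_sub_le (hX : IsSubordinator X P) (hb : b ≠ 0) (ht : b * t = a)
    {δ : ℝ} (hδ : 0 < δ) (n : ℕ) :
    ∫⁻ ω, ENNReal.ofReal ((∑ k ∈ Finset.range (2 ^ n),
      min ((X ((k + 1 : ℕ) * (t / 2 ^ n)) ω - X (k * (t / 2 ^ n)) ω) / δ) 1 -
        dyadicTruncMean X P t n δ / δ) ^ 2) ∂P ≤ ENNReal.ofReal (truncMean X P t δ / δ) := by
  set h := t / 2 ^ n with hh
  set φ : ℝ → ℝ := fun x ↦ min (x / δ) 1 with hφ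
  have hφm : Measurable φ := by fun_prop
  set D : ℕ → Ω → ℝ := fun k ω ↦ φ (X ((k + 1 : ℕ) * h) ω - X (k * h) ω) with hD
  have hcm : Monotone fun k : ℕ ↦ (k : ℝ≥0) * h := fun i j hij ↦ by simp only; gcongr
  have hDm : ∀ k, Measurable (D k) := fun k ↦
    hφm.comp ((hX.measurable _).sub (hX.measurable _))
  have hD01 : ∀ k, ∀ᵐ ω ∂P, 0 ≤ D k ω ∧ D k ω ≤ 1 := fun k ↦ by
    filter_upwards [hX.mono] with ω hm
    refine ⟨le_min (div_nonneg (sub_nonneg.2 (hm (hcm (Nat.le_succ k)))) hδ.le) zero_le_one,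
      min_le_right _ _⟩
  have hDp : ∀ k, MemLp (D k) 2 P := fun k ↦ by
    refine MemLp.of_bound (hDm k).aestronglyMeasurable 1 ?_
    filter_upwards [hD01 k] with ω hω
    rw [Real.norm_eq_abs, abs_of_nonneg hω.1]
    exact hω.2
  have hDi : ∀ k, Integrable (D k) P := fun k ↦ (hDp k).integrable (by norm_num)
  have hDe : ∀ k, ∫ ω, D k ω ∂P = (∫ ω, min (X h ω) δ ∂P) / δ := fun k ↦ by
    have h1 := ((hX.stationary (k * h) h).comp hφm).integral_eq
    have h2 : (k : ℝ≥0) * h + h = (k + 1 : ℕ) * h := by push_cast; ring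
    rw [h2] at h1
    rw [← integral_div]
    refine h1.trans (integral_congr_ae (Eventually.of_forall fun ω ↦ ?_))
    simp only [Function.comp_apply, hφ]
    rw [← min_div_div_right hδ.le, div_self hδ.ne']
  have hmean : ∫ ω, (∑ k ∈ Finset.range (2 ^ n), D k) ω ∂P = dyadicTruncMean X P t n δ / δ := by
    simp only [Finset.sum_apply]
    rw [integral_finsetSum _ fun k _ ↦ hDi k]
    simp only [hDe]
    rw [Finset.sum_const, Finset.card_range, nsmul_eq_mul, dyadicTruncMean, ← hh]
    push_cast
    ring
  have hind : iIndepFun D P :=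
    (hX.indep.nat hcm).comp (fun _ ↦ φ) (fun _ ↦ hφm)
  have hvar : Var[∑ k ∈ Finset.range (2 ^ n), D k; P] ≤ dyadicTruncMean X P t n δ / δ := by
    rw [IndepFun.variance_sum (fun k _ ↦ hDp k) (fun i _ j _ hij ↦ hind.indepFun hij)]
    rw [← hmean]
    simp only [Finset.sum_apply]
    rw [integral_finsetSum _ fun k _ ↦ hDi k]
    refine Finset.sum_le_sum fun k _ ↦ ?_
    refine (variance_le_expectation_sq (hDm k).aestronglyMeasurable).trans ?_
    refine integral_mono_ae (hDp k).integrable_sq (hDi k) ?_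
    filter_upwards [hD01 k] with ω hω
    simp only [Pi.pow_apply]
    nlinarith [hω.1, hω.2]
  have hsum : MemLp (∑ k ∈ Finset.range (2 ^ n), D k) 2 P := memLp_finsetSum' _ fun k _ ↦ hDp k
  rw [variance_eq_integral hsum.aestronglyMeasurable.aemeasurable, hmean] at hvar
  have hint : Integrable (fun ω ↦ ((∑ k ∈ Finset.range (2 ^ n), D k) ω -
      dyadicTruncMean X P t n δ / δ) ^ 2) P := (hsum.sub (memLp_const _)).integrable_sq
  simp only [Finset.sum_apply] at hvar hint
  rw [← ofReal_integral_eq_lintegral_ofReal hint (Eventually.of_forall fun ω ↦ sq_nonneg _)]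
  refine ENNReal.ofReal_le_ofReal (hvar.trans ?_)
  gcongr
  exact hX.dyadicTruncMean_le_truncMean hb ht hδ n

/-- Second moment bound for the fluctuations of the shortened count around its mean. -/
theorem lintegral_sq_shortenedCount_sub_le (hX : IsSubordinator X P) (hb : b ≠ 0)
    (ht : b * t = a) (ht0 : 0 < t) {δ : ℝ} (hδ : 0 < δ) :
    ∫⁻ ω, ENNReal.ofReal ((shortenedCount X t δ ω - truncMean X P t δ / δ) ^ 2) ∂P ≤
      ENNReal.ofReal (truncMean X P t δ / δ) := by
  have hlim : ∀ᵐ ω ∂P, Tendsto (fun n : ℕ ↦ ENNReal.ofReal ((∑ k ∈ Finset.range (2 ^ n),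
      min ((X ((k + 1 : ℕ) * (t / 2 ^ n)) ω - X (k * (t / 2 ^ n)) ω) / δ) 1 -
        dyadicTruncMean X P t n δ / δ) ^ 2)) atTop
      (𝓝 (ENNReal.ofReal ((shortenedCount X t δ ω - truncMean X P t δ / δ) ^ 2))) := by
    filter_upwards [hX.ae_isPath] with ω hω
    exact ENNReal.tendsto_ofReal (((tendsto_sum_min_increments hω.2.1 hω.2.2 hω.1 hδ ht0).sub
      ((hX.tendsto_dyadicTruncMean hb ht hδ).div_const δ)).pow 2)
  rw [lintegral_congr_ae (hlim.mono fun ω hω ↦ hω.liminf_eq.symm)]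
  have hm := hX.measurable
  -- Fatou's lemma carries the dyadic variance bound, whose right side is free of `n`, to the limit.
  refine (lintegral_liminf_le fun n ↦ by fun_prop).trans ?_
  refine liminf_le_of_frequently_le' (Frequently.of_forall fun n ↦ ?_)
  exact hX.lintegral_sq_sum_min_sub_le hb ht hδ n

/-- Along a sequence with summable inverse means, the shortened count concentrates. -/
theorem ae_tendsto_shortenedCount_div (hX : IsSubordinator X P) (hb : b ≠ 0)
    (ht : b * t = a) (ht0 : 0 < t) {d : ℕ → ℝ} (hd : ∀ k, 0 < d k)
    (hpos : ∀ᶠ k in atTop, 0 < truncMean X P t (d k) / d k)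
    (hsum : Summable fun k ↦ (truncMean X P t (d k) / d k)⁻¹) :
    ∀ᵐ ω ∂P, Tendsto (fun k ↦ shortenedCount X t (d k) ω / (truncMean X P t (d k) / d k)) atTop
      (𝓝 1) := by
  set M : ℕ → ℝ := fun k ↦ truncMean X P t (d k) / d k with hM
  have hM0 : ∀ k, 0 ≤ M k := fun k ↦ div_nonneg (hX.truncMean_nonneg hb ht (hd k)) (hd k).le
  set Z : ℕ → Ω → ENNReal := fun k ω ↦
    ENNReal.ofReal ((M k)⁻¹ ^ 2 * (shortenedCount X t (d k) ω - M k) ^ 2) with hZ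
  have hZm : ∀ k, AEMeasurable (Z k) P := fun k ↦ by
    have := hX.aemeasurable_shortenedCount ht0 (hd k)
    fun_prop
  have hZi : ∀ k, ∫⁻ ω, Z k ω ∂P ≤ ENNReal.ofReal (M k)⁻¹ := fun k ↦ by
    simp only [hZ, ENNReal.ofReal_mul (sq_nonneg (M k)⁻¹)]
    rw [lintegral_const_mul' _ _ ENNReal.ofReal_ne_top]
    refine (mul_le_mul_right (hX.lintegral_sq_shortenedCount_sub_le hb ht ht0 (hd k)) _).trans ?_
    rw [← ENNReal.ofReal_mul (sq_nonneg _)]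
    refine ENNReal.ofReal_le_ofReal (le_of_eq ?_)
    change (M k)⁻¹ ^ 2 * M k = (M k)⁻¹
    -- If `M k = 0`, both sides vanish because `0⁻¹ = 0`.
    rcases (hM0 k).eq_or_lt with h | h
    · simp [← h]
    · field_simp
  -- The series of normalised squares has finite expectation, hence converges almost surely, and its
  -- terms tend to `0`.
  have htot : ∫⁻ ω, ∑' k, Z k ω ∂P ≠ ⊤ := by
    rw [lintegral_tsum hZm]
    refine ne_top_of_le_ne_top ?_ (ENNReal.tsum_le_tsum hZi)
    exact hsum.tsum_ofReal_ne_top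
  have hae := ae_lt_top' (AEMeasurable.tsum hZm) htot
  filter_upwards [hae] with ω hω
  have h1 := ENNReal.tendsto_atTop_zero_of_tsum_ne_top hω.ne
  have h2 : Tendsto (fun k ↦ (M k)⁻¹ ^ 2 * (shortenedCount X t (d k) ω - M k) ^ 2) atTop (𝓝 0) := by
    have := (ENNReal.tendsto_toReal ENNReal.zero_ne_top).comp h1
    refine this.congr fun k ↦ ?_
    simp only [hZ, Function.comp_apply]
    exact ENNReal.toReal_ofReal (by positivity)
  have h3 : Tendsto (fun k ↦ |(M k)⁻¹ * (shortenedCount X t (d k) ω - M k)|) atTop (𝓝 0) := by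
    have := (Real.continuous_sqrt.tendsto 0).comp h2
    rw [Real.sqrt_zero] at this
    refine this.congr fun k ↦ ?_
    rw [Function.comp_apply, ← mul_pow, Real.sqrt_sq_eq_abs]
  have h4 := (tendsto_zero_iff_abs_tendsto_zero _).2 h3
  have h5 := h4.add_const 1
  rw [zero_add] at h5
  refine h5.congr' ?_
  filter_upwards [hpos] with k hk
  have hk' : 0 < M k := hk
  change (M k)⁻¹ * (shortenedCount X t (d k) ω - M k) + 1 = shortenedCount X t (d k) ω / M k
  field_simp
  ring

end IsSubordinator

/-! ### Interpolation and regular variation. -/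

/-- Interpolation of an asymptotic equivalence of antitone functions along geometric sequences. -/
theorem tendsto_div_of_tendsto_geometric {L M : ℝ → ℝ} {α : ℝ}
    (hL : ∀ {δ ε : ℝ}, 0 < δ → δ ≤ ε → L ε ≤ L δ) (hM : ∀ {δ ε : ℝ}, 0 < δ → δ ≤ ε → M ε ≤ M δ)
    (hL0 : ∀ {δ : ℝ}, 0 < δ → 0 ≤ L δ)
    (hpos : ∀ᶠ δ in 𝓝[>] (0 : ℝ), 0 < M δ) {r : ℕ → ℝ} (hr0 : ∀ m, 0 < r m) (hr1 : ∀ m, r m < 1)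
    (hr : Tendsto r atTop (𝓝 1))
    (hseq : ∀ m, Tendsto (fun k : ℕ ↦ L (r m ^ k) / M (r m ^ k)) atTop (𝓝 1))
    (hreg : ∀ c, 0 < c → Tendsto (fun δ ↦ M (c * δ) / M δ) (𝓝[>] 0) (𝓝 (c ^ (-α)))) :
    Tendsto (fun δ ↦ L δ / M δ) (𝓝[>] 0) (𝓝 1) := by
  have hpow : ∀ m, Tendsto (fun k : ℕ ↦ r m ^ k) atTop (𝓝[>] 0) := fun m ↦
    tendsto_nhdsWithin_iff.2 ⟨tendsto_pow_atTop_nhds_zero_of_lt_one (hr0 m).le (hr1 m),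
      Eventually.of_forall fun k ↦ pow_pos (hr0 m) k⟩
  have hratio : ∀ m, Tendsto (fun k : ℕ ↦ M (r m ^ (k + 1)) / M (r m ^ k)) atTop
      (𝓝 (r m ^ (-α))) := fun m ↦ by
    refine ((hreg _ (hr0 m)).comp (hpow m)).congr fun k ↦ ?_
    simp only [Function.comp_apply, pow_succ']
  have hposk : ∀ m, ∀ᶠ k : ℕ in atTop, 0 < M (r m ^ k) := fun m ↦ (hpow m).eventually hpos
  -- For `r^(k+1) < δ ≤ r^k` monotonicity gives `L(r^k)/M(r^(k+1)) ≤ L(δ)/M(δ) ≤ L(r^(k+1))/M(r^k)`.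
  -- For fixed `m` the outer terms tend to `r^α` and `r^(-α)`, both close to `1` for large `m`.
  have hlow : ∀ m, Tendsto (fun k : ℕ ↦ L (r m ^ k) / M (r m ^ (k + 1))) atTop
      (𝓝 (r m ^ (-α))⁻¹) := fun m ↦ by
    have h1 := (hseq m).div (hratio m) (Real.rpow_pos_of_pos (hr0 m) _).ne'
    rw [one_div] at h1
    refine h1.congr' ?_
    filter_upwards [hposk m] with k hk
    simp only [Pi.div_apply]
    field_simp
  have hupp : ∀ m, Tendsto (fun k : ℕ ↦ L (r m ^ (k + 1)) / M (r m ^ k)) atTop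
      (𝓝 (r m ^ (-α))) := fun m ↦ by
    have h1 := ((hseq m).comp (tendsto_add_atTop_nat 1)).mul (hratio m)
    rw [one_mul] at h1
    refine h1.congr' ?_
    filter_upwards [(tendsto_add_atTop_nat 1).eventually (hposk m)] with k hk
    simp only [Function.comp_apply]
    field_simp
  have hrα : Tendsto (fun m ↦ r m ^ (-α)) atTop (𝓝 1) := by
    simpa [Function.comp_def] using
      (Real.continuousAt_rpow_const 1 (-α) (Or.inl one_ne_zero)).tendsto.comp hr
  have hsmall : ∀ m (N : ℕ), ∀ᶠ δ in 𝓝[>] (0 : ℝ), ∃ k, N ≤ k ∧ r m ^ (k + 1) < δ ∧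
      δ ≤ r m ^ k := fun m N ↦ by
    filter_upwards [self_mem_nhdsWithin,
      mem_nhdsWithin_of_mem_nhds (Iio_mem_nhds (pow_pos (hr0 m) N))] with δ hδ0 hδN
    have hδ1 : δ ≤ 1 := (Set.mem_Iio.1 hδN).le.trans (pow_le_one₀ (hr0 m).le (hr1 m).le)
    obtain ⟨k, hk1, hk2⟩ := exists_nat_pow_near_of_lt_one hδ0 hδ1 (hr0 m) (hr1 m)
    refine ⟨k, ?_, hk1, hk2⟩
    have := (pow_lt_pow_iff_right_of_lt_one₀ (hr0 m) (hr1 m)).1 (hk1.trans hδN)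
    omega
  refine tendsto_order.2 ⟨fun c hc ↦ ?_, fun c hc ↦ ?_⟩
  · have hinv : Tendsto (fun m ↦ (r m ^ (-α))⁻¹) atTop (𝓝 1) := by
      simpa using hrα.inv₀ one_ne_zero
    obtain ⟨m, hm⟩ := (hinv.eventually (lt_mem_nhds hc)).exists
    obtain ⟨N, hN⟩ := eventually_atTop.1 ((hlow m).eventually (lt_mem_nhds hm))
    filter_upwards [hsmall m N, hpos, self_mem_nhdsWithin] with δ ⟨k, hNk, hk1, hk2⟩ hδM hδ0
    have hk0 := pow_pos (hr0 m) (k + 1)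
    refine (hN k hNk).trans_le ?_
    exact div_le_div₀ (hL0 hδ0) (hL hδ0 hk2) hδM (hM hk0 hk1.le)
  · obtain ⟨m, hm⟩ := (hrα.eventually (gt_mem_nhds hc)).exists
    obtain ⟨N, hN⟩ := eventually_atTop.1 (((hupp m).eventually (gt_mem_nhds hm)).and (hposk m))
    filter_upwards [hsmall m N, self_mem_nhdsWithin] with δ ⟨k, hNk, hk1, hk2⟩ hδ0
    have hk0 := pow_pos (hr0 m) (k + 1)
    refine lt_of_le_of_lt ?_ (hN k hNk).1
    exact div_le_div₀ (hL0 hk0) (hL hk0 hk1.le) (hN k hNk).2 (hM hδ0 hk2)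

theorem IsSlowlyVarying.eventually_pos {F : ℝ → ℝ} (hF : IsSlowlyVarying F) :
    ∀ᶠ x in atTop, 0 < F x := by
  obtain ⟨⟨A, hA, -⟩, -⟩ := hF
  filter_upwards [eventually_ge_atTop A] with x hx using hA x hx

theorem eventually_pos_of_isEquivalent {ι : Type*} {l : Filter ι} {f g : ι → ℝ} (h : f ~[l] g)
    (hg : ∀ᶠ x in l, 0 < g x) : ∀ᶠ x in l, 0 < f x := by
  have h1 := (isEquivalent_iff_tendsto_one (hg.mono fun x hx ↦ hx.ne')).1 h
  filter_upwards [hg, h1.eventually (lt_mem_nhds one_pos)] with x hx hx'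
  exact (div_pos_iff_of_pos_right hx).1 hx'

/-- An index-`α` regularly varying function, in the sense of the ratio limits. -/
theorem tendsto_ratio_of_isEquivalent {Φ F : ℝ → ℝ} {α : ℝ} (hF : IsSlowlyVarying F)
    (hΦ : Φ ~[atTop] fun u : ℝ ↦ u ^ α * F u) {c : ℝ} (hc : 0 < c) :
    Tendsto (fun u ↦ Φ (c * u) / Φ u) atTop (𝓝 (c ^ α)) := by
  have hcu : Tendsto (fun u : ℝ ↦ c * u) atTop atTop := tendsto_id.const_mul_atTop hc
  have h1 := (hΦ.comp_tendsto hcu).div hΦ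
  have h2 : Tendsto (fun u ↦ c ^ α * (F (c * u) / F u)) atTop (𝓝 (c ^ α)) := by
    simpa using (hF.2 c hc).const_mul (c ^ α)
  refine h1.symm.tendsto_nhds (h2.congr' ?_)
  filter_upwards [eventually_gt_atTop 0] with u hu
  have hu' : u ^ α ≠ 0 := (Real.rpow_pos_of_pos hu α).ne'
  simp only [Pi.div_apply, Function.comp_apply]
  rw [Real.mul_rpow hc.le hu.le]
  rw [mul_div_mul_comm, mul_div_cancel_right₀ _ hu']

theorem tendsto_one_div_nhdsGT_zero : Tendsto (fun δ : ℝ ↦ 1 / δ) (𝓝[>] 0) atTop := by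
  simpa only [one_div] using tendsto_inv_nhdsGT_zero

/-! ### The asymptotics at a fixed rational time. -/

namespace IsSubordinator

variable {Ω : Type*} [MeasurableSpace Ω] {P : Measure Ω} [IsProbabilityMeasure P]
  {X : ℝ≥0 → Ω → ℝ} {a b : ℕ} {t : ℝ≥0} {α : ℝ} {F : ℝ → ℝ}

/-- This is the Tauberian theorem for `Ψ = t Φ` read at `r = 1/δ`, where `r U(1/r)` becomes
`U(δ)/δ`. -/
theorem truncMean_div_isEquivalent (hX : IsSubordinator X P) (hb : b ≠ 0) (ht : b * t = a)
    (ht0 : 0 < t) (hα₁ : α < 1) (hF : IsSlowlyVarying F)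
    (hΦ : laplaceExponent X P ~[atTop] fun u : ℝ ↦ u ^ α * F u) :
    (fun δ ↦ truncMean X P t δ / δ) ~[𝓝[>] 0]
      fun δ ↦ t * (δ ^ (-α) * F (1 / δ) / Real.Gamma (2 - α)) := by
  have hΓ : 0 < Real.Gamma (2 - α) := Real.Gamma_pos_of_pos (by linarith)
  have ht0' : (0 : ℝ) < t := ht0
  have hGpos : ∀ᶠ u in atTop, 0 < u ^ α * F u := by
    filter_upwards [eventually_gt_atTop 0, hF.eventually_pos] with u hu hFu
    positivity
  have hΦpos := eventually_pos_of_isEquivalent hΦ hGpos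
  have h1 := tendsto_of_laplace_regularlyVarying (U := truncMean X P t)
    (Ψ := fun r ↦ t * laplaceExponent X P r) (hX.monotoneOn_truncMean hb ht)
    (fun x hx ↦ hX.truncMean_nonneg hb ht hx)
    (fun r hr ↦ (hX.integrableOn_and_laplace_truncMean hb ht hr).1)
    (fun r hr ↦ (hX.integrableOn_and_laplace_truncMean hb ht hr).2) hα₁
    (hΦpos.mono fun r hr ↦ mul_pos ht0' hr)
    (fun c hc ↦ (tendsto_ratio_of_isEquivalent hF hΦ hc).congr fun u ↦
      (mul_div_mul_left _ _ ht0'.ne').symm)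
  have h2 := h1.comp tendsto_one_div_nhdsGT_zero
  have h3 := ((isEquivalent_iff_tendsto_one (hGpos.mono fun x hx ↦ hx.ne')).1 hΦ).comp
    tendsto_one_div_nhdsGT_zero
  have h4 := (h2.mul h3).mul_const (Real.Gamma (2 - α))
  rw [mul_one, one_div_mul_cancel hΓ.ne'] at h4
  have hGpos' := tendsto_one_div_nhdsGT_zero.eventually hGpos
  have hΦpos' := tendsto_one_div_nhdsGT_zero.eventually hΦpos
  have hrpow : ∀ {δ : ℝ}, 0 < δ → δ ^ (-α) = (1 / δ) ^ α := fun {δ} hδ ↦ by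
    rw [one_div, Real.inv_rpow hδ.le, Real.rpow_neg hδ.le]
  refine (isEquivalent_iff_tendsto_one ?_).2 (h4.congr' ?_)
  · filter_upwards [hGpos', self_mem_nhdsWithin] with δ hδ hδ0
    rw [hrpow hδ0]
    positivity
  · filter_upwards [hGpos', hΦpos', self_mem_nhdsWithin] with δ hδ hδΦ hδ0
    have hδ0' : 0 < δ := hδ0
    simp only [Pi.div_apply, Function.comp_apply, one_div_one_div]
    rw [hrpow hδ0']
    generalize (1 / δ) ^ α * F (1 / δ) = G at *
    generalize laplaceExponent X P (1 / δ) = p at *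
    field_simp

theorem ae_shortenedCount_isEquivalent_of_rat (hX : IsSubordinator X P) (hb : b ≠ 0)
    (ht : b * t = a) (ht0 : 0 < t) (hα₀ : 0 < α) (hα₁ : α < 1) (hF : IsSlowlyVarying F)
    (hΦ : laplaceExponent X P ~[atTop] fun u : ℝ ↦ u ^ α * F u) :
    ∀ᵐ ω ∂P, (fun δ ↦ shortenedCount X t δ ω) ~[𝓝[>] 0]
      fun δ ↦ t * (δ ^ (-α) * F (1 / δ) / Real.Gamma (2 - α)) := by
  have hΓ : 0 < Real.Gamma (2 - α) := Real.Gamma_pos_of_pos (by linarith)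
  have ht0' : (0 : ℝ) < t := ht0
  have hequiv := hX.truncMean_div_isEquivalent hb ht ht0 hα₁ hF hΦ
  have hpos : ∀ᶠ δ in 𝓝[>] (0 : ℝ), 0 < truncMean X P t δ / δ := by
    refine eventually_pos_of_isEquivalent hequiv ?_
    filter_upwards [tendsto_one_div_nhdsGT_zero.eventually hF.eventually_pos,
      self_mem_nhdsWithin] with δ hδ hδ0
    have := Real.rpow_pos_of_pos (Set.mem_Ioi.1 hδ0) (-α)
    positivity
  have hreg : ∀ c : ℝ, 0 < c → Tendsto
      (fun δ ↦ (truncMean X P t (c * δ) / (c * δ)) / (truncMean X P t δ / δ)) (𝓝[>] 0)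
      (𝓝 (c ^ (-α))) := by
    intro c hc
    have hcδ : Tendsto (fun δ : ℝ ↦ c * δ) (𝓝[>] 0) (𝓝[>] 0) := by
      refine tendsto_nhdsWithin_iff.2 ⟨?_, ?_⟩
      · have : Tendsto (fun δ : ℝ ↦ c * δ) (𝓝 0) (𝓝 (c * 0)) := (continuous_const_mul c).tendsto 0
        rw [mul_zero] at this
        exact this.mono_left nhdsWithin_le_nhds
      · filter_upwards [self_mem_nhdsWithin] with δ hδ using mul_pos hc hδ
    have h1 := (hequiv.comp_tendsto hcδ).div hequiv
    have h2 := ((hF.2 c⁻¹ (inv_pos.2 hc)).comp tendsto_one_div_nhdsGT_zero).const_mul (c ^ (-α))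
    rw [mul_one] at h2
    refine h1.symm.tendsto_nhds (h2.congr' ?_)
    filter_upwards [self_mem_nhdsWithin] with δ hδ
    have hδ0 : 0 < δ := hδ
    have hδα : δ ^ (-α) ≠ 0 := (Real.rpow_pos_of_pos hδ0 _).ne'
    simp only [Pi.div_apply, Function.comp_apply]
    rw [Real.mul_rpow hc.le hδ0.le, show (1 : ℝ) / (c * δ) = c⁻¹ * (1 / δ) by field_simp]
    generalize F (c⁻¹ * (1 / δ)) = p
    generalize F (1 / δ) = q
    field_simp
  -- Countably many ratios increasing to `1` keep the exceptional set null; the shift by `2` makes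
  -- `r 0 = 1/2` positive.
  set r : ℕ → ℝ := fun m ↦ 1 - 1 / ((m : ℝ) + 2) with hr
  have hm2 : ∀ m : ℕ, 1 / ((m : ℝ) + 2) < 1 := fun m ↦ by
    rw [div_lt_one (by positivity)]
    have : (0 : ℝ) ≤ m := m.cast_nonneg
    linarith
  have hr0 : ∀ m, 0 < r m := fun m ↦ sub_pos.2 (hm2 m)
  have hr1 : ∀ m, r m < 1 := fun m ↦ by
    have : 0 < 1 / ((m : ℝ) + 2) := by positivity
    simp only [hr]; linarith
  have hrlim : Tendsto r atTop (𝓝 1) := by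
    have h1 : Tendsto (fun m : ℕ ↦ 1 / ((m : ℝ) + 2)) atTop (𝓝 0) :=
      tendsto_const_nhds.div_atTop (tendsto_atTop_add_const_right _ _ tendsto_natCast_atTop_atTop)
    simpa only [sub_zero] using h1.const_sub 1
  have hseq : ∀ m, ∀ᵐ ω ∂P, Tendsto (fun k : ℕ ↦ shortenedCount X t (r m ^ k) ω /
      (truncMean X P t (r m ^ k) / r m ^ k)) atTop (𝓝 1) := by
    intro m
    have hpow : Tendsto (fun k : ℕ ↦ r m ^ k) atTop (𝓝[>] 0) :=
      tendsto_nhdsWithin_iff.2 ⟨tendsto_pow_atTop_nhds_zero_of_lt_one (hr0 m).le (hr1 m),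
        Eventually.of_forall fun k ↦ pow_pos (hr0 m) k⟩
    have hposk := hpow.eventually hpos
    refine hX.ae_tendsto_shortenedCount_div hb ht ht0 (fun k ↦ pow_pos (hr0 m) k) hposk ?_
    -- Successive inverse means have limiting ratio `r^α`, which is below `1` because `α > 0`.
    refine summable_of_ratio_test_tendsto_lt_one (l := (r m ^ (-α))⁻¹) ?_
      (hposk.mono fun k hk ↦ (inv_pos.2 hk).ne') ?_
    · rw [← Real.rpow_neg (hr0 m).le, neg_neg]
      exact Real.rpow_lt_one (hr0 m).le (hr1 m) hα₀
    · have h1 := ((hreg _ (hr0 m)).comp hpow).inv₀ (Real.rpow_pos_of_pos (hr0 m) _).ne'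
      refine h1.congr' ?_
      filter_upwards [hposk, (tendsto_add_atTop_nat 1).eventually hposk] with k hk hk1
      rw [Real.norm_of_nonneg (inv_pos.2 hk).le, Real.norm_of_nonneg (inv_pos.2 hk1).le]
      simp only [Function.comp_apply, ← pow_succ']
      rw [inv_div, inv_div_inv]
  filter_upwards [ae_all_iff.2 hseq, hX.ae_isPath] with ω hω hpath
  refine IsEquivalent.trans ?_ hequiv
  refine (isEquivalent_iff_tendsto_one (hpos.mono fun δ hδ ↦ hδ.ne')).2 ?_
  exact tendsto_div_of_tendsto_geometric (L := fun δ ↦ shortenedCount X t δ ω)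
    (M := fun δ ↦ truncMean X P t δ / δ)
    (fun hδ h ↦ shortenJumps_anti_size hpath.2.1 hpath.2.2 hpath.1 hδ h t)
    (fun hδ h ↦ hX.truncMean_div_anti_size hb ht hδ h)
    (fun hδ ↦ shortenJumps_nonneg hpath.2.1 hpath.2.2 hpath.1 hδ t)
    hpos hr0 hr1 hrlim hω hreg

end IsSubordinator

/-! ### From rational times to all times. -/

/-- An asymptotic equivalence `L t ~ t G` for rational times extends to all times by
monotonicity. -/
theorem isEquivalent_of_forall_rat {L : ℝ≥0 → ℝ → ℝ} {G : ℝ → ℝ}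
    (hG : ∀ᶠ δ in 𝓝[>] (0 : ℝ), 0 < G δ)
    (hmono : ∀ {s t : ℝ≥0} {δ : ℝ}, 0 < δ → s ≤ t → L s δ ≤ L t δ)
    (hrat : ∀ q : ℚ≥0, 0 < q → L (q : ℝ≥0) ~[𝓝[>] 0] fun δ ↦ ((q : ℝ≥0) : ℝ) * G δ)
    {t : ℝ≥0} (ht : 0 < t) : L t ~[𝓝[>] 0] fun δ ↦ (t : ℝ) * G δ := by
  have ht' : (0 : ℝ) < t := ht
  have hq : ∀ q : ℚ≥0, 0 < q →
      Tendsto (fun δ ↦ L (q : ℝ≥0) δ / (t * G δ)) (𝓝[>] 0) (𝓝 (((q : ℝ≥0) : ℝ) / t)) := by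
    intro q hq
    have hq' : (0 : ℝ) < ((q : ℝ≥0) : ℝ) := by exact_mod_cast hq
    have h1 := ((isEquivalent_iff_tendsto_one
      (hG.mono fun δ hδ ↦ (mul_pos hq' hδ).ne')).1 (hrat q hq)).mul_const (((q : ℝ≥0) : ℝ) / t)
    rw [one_mul] at h1
    refine h1.congr' ?_
    filter_upwards [hG] with δ hδ
    simp only [Pi.div_apply]
    field_simp
  refine (isEquivalent_iff_tendsto_one (hG.mono fun δ hδ ↦ (mul_pos ht' hδ).ne')).2 ?_
  refine tendsto_order.2 ⟨fun c hc ↦ ?_, fun c hc ↦ ?_⟩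
  · have h0 : max 0 (c * t) < t := max_lt ht' (by nlinarith)
    obtain ⟨q, hq1, hq2⟩ := exists_rat_btwn h0
    have hq0 : (0 : ℝ) < q := (le_max_left _ _).trans_lt hq1
    have hq0' : 0 < q := by exact_mod_cast hq0
    lift q to ℚ≥0 using hq0'.le
    have hcast : (((q : ℝ≥0) : ℝ)) = ((q : ℚ) : ℝ) := by
      rw [Rat.cast_nnratCast]; exact map_nnratCast NNReal.toRealHom q
    have hlim := hq q (by exact_mod_cast hq0')
    have hc' : c < ((q : ℝ≥0) : ℝ) / t := by
      rw [lt_div_iff₀ ht', hcast]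
      exact (le_max_right _ _).trans_lt hq1
    filter_upwards [hlim.eventually (lt_mem_nhds hc'), hG, self_mem_nhdsWithin] with δ hδ hGδ hδ0
    refine hδ.trans_le ?_
    have hle : (q : ℝ≥0) ≤ t := by
      rw [← NNReal.coe_le_coe, hcast]; exact hq2.le
    exact div_le_div_of_nonneg_right (hmono hδ0 hle) (mul_pos ht' hGδ).le
  · have h0 : (t : ℝ) < c * t := by nlinarith
    obtain ⟨q, hq1, hq2⟩ := exists_rat_btwn h0
    have hq0 : (0 : ℝ) < q := ht'.trans hq1
    have hq0' : 0 < q := by exact_mod_cast hq0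
    lift q to ℚ≥0 using hq0'.le
    have hcast : (((q : ℝ≥0) : ℝ)) = ((q : ℚ) : ℝ) := by
      rw [Rat.cast_nnratCast]; exact map_nnratCast NNReal.toRealHom q
    have hlim := hq q (by exact_mod_cast hq0')
    have hc' : ((q : ℝ≥0) : ℝ) / t < c := by
      rw [div_lt_iff₀ ht', hcast]
      exact hq2
    filter_upwards [hlim.eventually (gt_mem_nhds hc'), hG, self_mem_nhdsWithin] with δ hδ hGδ hδ0
    refine lt_of_le_of_lt ?_ hδ
    have hle : t ≤ (q : ℝ≥0) := by
      rw [← NNReal.coe_le_coe, hcast]; exact hq1.le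
    exact div_le_div_of_nonneg_right (hmono hδ0 hle) (mul_pos ht' hGδ).le

theorem corollary5p4 {Ω : Type*} [MeasurableSpace Ω] (P : Measure Ω) [IsProbabilityMeasure P]
    (X : ℝ≥0 → Ω → ℝ) (hX : IsSubordinator X P)
    (α : ℝ) (hα₀ : 0 < α) (hα₁ : α < 1)
    (F : ℝ → ℝ) (hF : IsSlowlyVarying F)
    (hΦ : laplaceExponent X P ~[atTop] fun u : ℝ ↦ u ^ α * F u) :
    ∀ᵐ ω ∂P, ∀ t : ℝ≥0, 0 < t →
      (fun δ : ℝ ↦ shortenedCount X t δ ω) ~[𝓝[>] 0]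
        fun δ : ℝ ↦ (t : ℝ) * δ ^ (-α) * F (1 / δ) / Real.Gamma (2 - α) := by
  have hΓ : 0 < Real.Gamma (2 - α) := Real.Gamma_pos_of_pos (by linarith)
  have hrat : ∀ q : ℚ≥0, ∀ᵐ ω ∂P, 0 < q →
      (fun δ ↦ shortenedCount X (q : ℝ≥0) δ ω) ~[𝓝[>] 0]
        fun δ ↦ ((q : ℝ≥0) : ℝ) * (δ ^ (-α) * F (1 / δ) / Real.Gamma (2 - α)) := by
    intro q
    rcases eq_zero_or_pos q with rfl | hq
    · simp
    · have hden : ((q.den : ℕ) : ℝ≥0) * (q : ℝ≥0) = (q.num : ℕ) := by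
        have h := NNRat.den_mul_eq_num q
        exact_mod_cast congrArg (NNRat.cast : ℚ≥0 → ℝ≥0) h
      filter_upwards [hX.ae_shortenedCount_isEquivalent_of_rat q.den_ne_zero hden
        (by exact_mod_cast hq) hα₀ hα₁ hF hΦ] with ω hω _ using hω
  filter_upwards [ae_all_iff.2 hrat, hX.ae_isPath] with ω hω hpath t ht
  have := isEquivalent_of_forall_rat (L := fun t δ ↦ shortenedCount X t δ ω)
    (G := fun δ ↦ δ ^ (-α) * F (1 / δ) / Real.Gamma (2 - α)) ?_
    (fun hδ hst ↦ shortenJumps_mono_time hpath.2.1 hpath.2.2 hpath.1 hδ hst) hω ht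
  · refine this.congr_right (Eventually.of_forall fun δ ↦ ?_)
    simp only
    ring
  · filter_upwards [tendsto_one_div_nhdsGT_zero.eventually hF.eventually_pos,
      self_mem_nhdsWithin] with δ hδ hδ0
    have := Real.rpow_pos_of_pos (Set.mem_Ioi.1 hδ0) (-α)
    positivity
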